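/- All Hilbert spaces are finite-dimensional and complex. For a density operator $\sigma$ with spectral decomposition $\sigma=\sum_i\lambda_iQ_i$ ($Q_i$ rank-one projectors onto an orthonormal eigenbasis) and a normalized operator monotone function $f:(0,\infty)\to[0,\infty)$, put $$\mathbf J_{f,\sigma}(X)=\sum_{i,j}P_f(\lambda_i,\lambda_j)\,Q_iXQ_j,\qquad \langle X,Y\rangle_{f,\sigma}=\operatorname{Tr}[X^*\mathbf J_{f,\sigma}(Y)],$$ where $P_f(x,y)=y f(x/y)$ for $x,y>0$, $P_f(0,y)=y\lim_{t\downarrow0}f(t)$ and $P_f(x,0)=x\lim_{t\to\infty}f(t)/t$. For a density operator $\rho_{AB}$ on $A\otimes B$ with marginals $\rho_A,\rho_B$, let $\mu_f^{\mathrm{Lin}}(A:B)_\rho$ be the supremum of $|\operatorname{Tr}[(X\otimes Y^*)\rho_{AB}]|$ over all linear operators $X$ on $A$ and $Y$ on $B$ with $$\langle \mathbb 1,X\rangle_{f,\rho_A}=\langle \mathbb 1,Y\rangle_{f,\rho_B}=0,\qquad \langle X,X\rangle_{f,\rho_A}=\langle Y,Y\rangle_{f,\rho_B}=1,$$ and let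 $\mu_f(A:B)_\rho$ be the same supremum restricted to Hermitian $X,Y$ (suprema over the empty set are $0$). Write $f_k(x)=x^k$, $f_{GM}(x)=\sqrt x$, $\mu_{GM}=\mu_{f_{GM}}$. The state $\rho_{AB}$ \emph{asymptotically has common data} if there are $p\in(0,1)$ and sequences of quantum channels (completely positive trace-preserving maps) $\mathcal E_n:\mathrm L(A^{\otimes n})\to \mathrm L(\mathbb C^2)$ and $\mathcal F_n:\mathrm L(B^{\otimes n})\to \mathrm L(\mathbb C^2)$ such that $$\lim_{n\to\infty}\bigl\|(\mathcal E_n\otimes\mathcal F_n)(\rho_{AB}^{\otimes n})-\bigl(p\,|0\rangle\langle0|\otimes|0\rangle\langle0|+(1-p)\,|1\rangle\langle1|\otimes|1\rangle\langle1|\bigr)\bigr\|_1=0 .$$ Theorem. If $\rho_{AB}$ asymptotically has common data, then $\mu^{\mathrm{Lin}}_{f_k}(A:B)_\rho=1$ for all $k\in(0,1/2)\cup(1/2,1)$, and $\mu_{GM}(A:B)_\rho=1$. -/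

import Mathlib

open scoped Kronecker ComplexOrder
open Matrix Filter Topology

noncomputable section

namespace QMaxCorr

/-! Finite-dimensional systems `A ≅ ℂ^d` are given by finite index types, operators by complex
matrices; the bipartite system `A ⊗ B` is indexed by `A × B`. -/

/-- Quantum states (density matrices). -/
structure IsState {ι : Type*} [Fintype ι] (ρ : Matrix ι ι ℂ) : Prop where
  posSemidef : ρ.PosSemidef
  trace_eq_one : ρ.trace = 1

/-- The marginal `ρ_A = Tr_B ρ_AB`. -/
def margA {A B : Type*} [Fintype B] (ρ : Matrix (A × B) (A × B) ℂ) : Matrix A A ℂ :=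
  Matrix.of fun i j => ∑ k, ρ (i, k) (j, k)

/-- The marginal `ρ_B = Tr_A ρ_AB`. -/
def margB {A B : Type*} [Fintype A] (ρ : Matrix (A × B) (A × B) ℂ) : Matrix B B ℂ :=
  Matrix.of fun k l => ∑ i, ρ (i, k) (i, l)

theorem margA_isHermitian {A B : Type*} [Fintype B] {ρ : Matrix (A × B) (A × B) ℂ}
    (h : ρ.IsHermitian) : (margA ρ).IsHermitian := by
  ext i j
  simp only [margA, Matrix.conjTranspose_apply, Matrix.of_apply, star_sum]
  exact Finset.sum_congr rfl fun k _ => h.apply _ _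

theorem margB_isHermitian {A B : Type*} [Fintype A] {ρ : Matrix (A × B) (A × B) ℂ}
    (h : ρ.IsHermitian) : (margB ρ).IsHermitian := by
  ext i j
  simp only [margB, Matrix.conjTranspose_apply, Matrix.of_apply, star_sum]
  exact Finset.sum_congr rfl fun k _ => h.apply _ _

/-! ### The operators `J_{f,σ}` and the maximal correlation coefficients -/

/-- The perspective function `P_f` on `[0,∞) × [0,∞)`: it is `y f(x/y)` for `x, y > 0`,
`y f(0⁺)` for `x = 0`, and `x f'(+∞)` for `y = 0`, where `f(0⁺) = lim_{x ↓ 0} f x` and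
`f'(+∞) = lim_{x → ∞} f x / x`. -/
def perspective (f : ℝ → ℝ) (x y : ℝ) : ℝ :=
  if y = 0 then x * limUnder atTop (fun t : ℝ => f t / t)
  else if x = 0 then y * limUnder (𝓝[>] (0 : ℝ)) f
  else y * f (x / y)

section Coefficients

variable {A : Type*} [Fintype A] [DecidableEq A]

/-- The rank-one projector onto the `i`-th vector of an orthonormal eigenbasis of `σ`. -/
def eigenProj {σ : Matrix A A ℂ} (hσ : σ.IsHermitian) (i : A) : Matrix A A ℂ :=
  Matrix.vecMulVec (⇑(hσ.eigenvectorBasis i)) (star ⇑(hσ.eigenvectorBasis i))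

/-- `J_{f,σ}(X) = ∑_{i,j} P_f(λ_i, λ_j) Q_i X Q_j`, where `σ = ∑_i λ_i Q_i` is a spectral
decomposition. -/
def opJ (f : ℝ → ℝ) {σ : Matrix A A ℂ} (hσ : σ.IsHermitian) (X : Matrix A A ℂ) : Matrix A A ℂ :=
  ∑ i, ∑ j, (perspective f (hσ.eigenvalues i) (hσ.eigenvalues j) : ℂ) •
    (eigenProj hσ i * X * eigenProj hσ j)

/-- `⟨X, Y⟩_{f,σ} = Tr[X^* J_{f,σ}(Y)]`. -/
def innerF (f : ℝ → ℝ) {σ : Matrix A A ℂ} (hσ : σ.IsHermitian) (X Y : Matrix A A ℂ) : ℂ :=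
  (Xᴴ * opJ f hσ Y).trace

variable {B : Type*} [Fintype B] [DecidableEq B]

/-- Feasibility of `(X, Y)`: both operators have mean zero and unit variance with respect to the
`f`-inner products of the marginals. -/
def Feasible (f : ℝ → ℝ) {ρ : Matrix (A × B) (A × B) ℂ} (hρ : IsState ρ)
    (X : Matrix A A ℂ) (Y : Matrix B B ℂ) : Prop :=
  innerF f (margA_isHermitian hρ.posSemidef.isHermitian) 1 X = 0 ∧
  innerF f (margB_isHermitian hρ.posSemidef.isHermitian) 1 Y = 0 ∧
  innerF f (margA_isHermitian hρ.posSemidef.isHermitian) X X = 1 ∧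
  innerF f (margB_isHermitian hρ.posSemidef.isHermitian) Y Y = 1

/-- `μ_f(A:B)_ρ`: the optimal value of `|Tr[(X ⊗ Y^*) ρ_AB]|` over Hermitian feasible `X`, `Y`. -/
def mu (f : ℝ → ℝ) {ρ : Matrix (A × B) (A × B) ℂ} (hρ : IsState ρ) : ℝ :=
  sSup {r : ℝ | ∃ (X : Matrix A A ℂ) (Y : Matrix B B ℂ), X.IsHermitian ∧ Y.IsHermitian ∧
    Feasible f hρ X Y ∧ r = ‖((X ⊗ₖ Yᴴ) * ρ).trace‖}

/-- `μ_f^Lin(A:B)_ρ`: the same supremum over all linear operators. -/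
def muLin (f : ℝ → ℝ) {ρ : Matrix (A × B) (A × B) ℂ} (hρ : IsState ρ) : ℝ :=
  sSup {r : ℝ | ∃ (X : Matrix A A ℂ) (Y : Matrix B B ℂ),
    Feasible f hρ X Y ∧ r = ‖((X ⊗ₖ Yᴴ) * ρ).trace‖}

end Coefficients

/-- `f_k(x) = x^k`. -/
def fPow (k : ℝ) : ℝ → ℝ := fun x => x ^ k

/-- The geometric mean function `f_GM(x) = √x`. -/
def fGM : ℝ → ℝ := fun x => √x

/-! ### Quantum channels -/

/-- The tensor product `E ⊗ F` of linear maps between matrix spaces, i.e. the linear map with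
`X ⊗ Y ↦ E(X) ⊗ F(Y)`, written out on matrix units. -/
def mapTensor {A B A' B' : Type*} [Fintype A] [DecidableEq A] [Fintype B] [DecidableEq B]
    (E : Matrix A A ℂ →ₗ[ℂ] Matrix A' A' ℂ) (F : Matrix B B ℂ →ₗ[ℂ] Matrix B' B' ℂ)
    (M : Matrix (A × B) (A × B) ℂ) : Matrix (A' × B') (A' × B') ℂ :=
  ∑ i, ∑ j, ∑ k, ∑ l,
    M (i, k) (j, l) • (E (Matrix.single i j 1) ⊗ₖ F (Matrix.single k l 1))

/-- Quantum channels: completely positive (`id_R ⊗ E` is positive for `R = ℂ^k` and every `k`)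
and trace-preserving linear maps. -/
structure IsChannel {A A' : Type*} [Fintype A] [DecidableEq A] [Fintype A']
    (E : Matrix A A ℂ →ₗ[ℂ] Matrix A' A' ℂ) : Prop where
  completelyPositive : ∀ (k : ℕ) (P : Matrix (Fin k × A) (Fin k × A) ℂ), P.PosSemidef →
    (mapTensor (LinearMap.id : Matrix (Fin k) (Fin k) ℂ →ₗ[ℂ] Matrix (Fin k) (Fin k) ℂ)
      E P).PosSemidef
  tracePreserving : ∀ X : Matrix A A ℂ, (E X).trace = X.trace

/-! ### Asymptotic common data -/

/-- `ρ_AB^{⊗ n}` as an operator on `A^n ⊗ B^n`. -/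
def tensorPower {A B : Type*} (ρ : Matrix (A × B) (A × B) ℂ) (n : ℕ) :
    Matrix ((Fin n → A) × (Fin n → B)) ((Fin n → A) × (Fin n → B)) ℂ :=
  Matrix.of fun x y => ∏ t, ρ (x.1 t, x.2 t) (y.1 t, y.2 t)

/-- The trace norm `‖M‖₁ = Tr √(M^* M)`, i.e. the sum of the square roots of the eigenvalues of
`M^* M`. -/
def traceNorm {ι : Type*} [Fintype ι] [DecidableEq ι] (M : Matrix ι ι ℂ) : ℝ :=
  ∑ i, √((Matrix.isHermitian_conjTranspose_mul_self M).eigenvalues i)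

/-- The perfectly correlated classical bit
`χ^{|p} = p |0⟩⟨0| ⊗ |0⟩⟨0| + (1 - p) |1⟩⟨1| ⊗ |1⟩⟨1|`. -/
def corrBit (p : ℝ) : Matrix (Fin 2 × Fin 2) (Fin 2 × Fin 2) ℂ :=
  (p : ℂ) • (Matrix.single 0 0 1 ⊗ₖ Matrix.single 0 0 1) +
    ((1 - p : ℝ) : ℂ) • (Matrix.single 1 1 1 ⊗ₖ Matrix.single 1 1 1)

/-- `ρ_AB` asymptotically has common data: for some `p ∈ (0,1)` there are sequences of local
quantum channels that convert `ρ_AB^{⊗ n}` to `χ^{|p}` up to an error in trace norm that tends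
to zero. -/
def HasAsymptoticCommonData {A B : Type*} [Fintype A] [DecidableEq A] [Fintype B] [DecidableEq B]
    (ρ : Matrix (A × B) (A × B) ℂ) : Prop :=
  ∃ (p : ℝ) (E : ∀ n : ℕ, Matrix (Fin n → A) (Fin n → A) ℂ →ₗ[ℂ] Matrix (Fin 2) (Fin 2) ℂ)
    (F : ∀ n : ℕ, Matrix (Fin n → B) (Fin n → B) ℂ →ₗ[ℂ] Matrix (Fin 2) (Fin 2) ℂ),
    0 < p ∧ p < 1 ∧ (∀ n, IsChannel (E n)) ∧ (∀ n, IsChannel (F n)) ∧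
    Tendsto (fun n => traceNorm (mapTensor (E n) (F n) (tensorPower ρ n) - corrBit p))
      atTop (𝓝 0)

end QMaxCorr

end

/-!
For `f(x) = x^k` with `0 < k < 1` one has `J_{f,σ}(X) = σ^k X σ^(1-k)`, so in an eigenbasis of `σ`
with eigenvalues `a` the squared norm of `X` is `∑ |X_ij|² a_i^k a_j^(1-k)`. A local change of basis
makes both marginals of `ρ` diagonal (`IsState.diagMarginals`).

*The coefficient is at most one.* At `k = 0` and `k = 1` the inequality
`|Tr[(X ⊗ Y^*) ρ]|² ≤ ‖X‖² ‖Y‖²` is the Cauchy-Schwarz inequality for the form `Tr[S^* T ρ]`. For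
`k` in between it follows from the Phragmen-Lindelof principle applied to the correlation of
`σ_A^(-s) X σ_A^s` and `σ_B^(-t) Y σ_B^t`, `t` the conjugate of `s`, on a vertical strip
(`DiagMarginals.norm_corr_le`).

*The coefficient is at least one.* In orthonormal coordinates of the weighted Hilbert-Schmidt
spaces the correlation form is a matrix `M` that maps the unit vector `u` of the identity on `A` to
that of the identity on `B`, and back by its adjoint. If mean-zero operators have correlation at
most `s < 1`, then `Mᴴ M ≤ uuᴴ + s² (1 - uuᴴ)`, and this operator inequality is stable under tensor
powers (`posSemidef_gap_tpow`). Hence on any number of copies mean-zero operators still have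
correlation at most `s` (`DiagMarginals.norm_corr_tensorPower_le`).

Asymptotic common data yields effects `E`, `F` on `n` copies whose probabilities and joint
probability all tend to `p ∈ (0,1)` (`HasAsymptoticCommonData.hasCorrelatedEffects`). The squared
norm of `E - Tr[E σ]` is at most `e - e²` with `e = Tr[E σ]`, because `E² ≤ E` (`wsq_effect_le`), so
in the limit the covariance bound reads `p - p² ≤ s (p - p²)`, which forces `1 ≤ s`
(`DiagMarginals.one_le_of_hasCorrelatedEffects`).

For `k = 1/2` the adjoint preserves the norm, and a bound for Hermitian operators extends to all
operators with the same constant (`norm_corr_le_of_hermitian`).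
-/

noncomputable section

namespace QMaxCorr

/-! ### The correlation form and its two Cauchy-Schwarz bounds -/

/-- The form `(X, Y) ↦ Tr[(X ⊗ Y^*) ρ]` whose size the correlation coefficients measure. It is
linear in `X` and conjugate-linear in `Y`. -/
def corr {A B : Type*} [Fintype A] [Fintype B] (ρ : Matrix (A × B) (A × B) ℂ)
    (X : Matrix A A ℂ) (Y : Matrix B B ℂ) : ℂ :=
  ((X ⊗ₖ Yᴴ) * ρ).trace

/-- `∑ |X_ij|² w_ij`, the squared norm of `X` in the Hilbert-Schmidt space with weights `w`. -/
def wsq {A : Type*} [Fintype A] (w : A → A → ℝ) (X : Matrix A A ℂ) : ℝ :=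
  ∑ i, ∑ j, ‖X i j‖ ^ 2 * w i j

section
variable {A B : Type*} [Fintype A] [Fintype B]

theorem corr_eq_sum (ρ : Matrix (A × B) (A × B) ℂ) (X : Matrix A A ℂ) (Y : Matrix B B ℂ) :
    corr ρ X Y = ∑ i, ∑ j, ∑ k, ∑ l, X i j * star (Y k l) * ρ (j, k) (i, l) := by
  simp only [corr, Matrix.trace, Matrix.diag, Matrix.mul_apply, Fintype.sum_prod_type,
    kroneckerMap_apply, conjTranspose_apply]
  refine Finset.sum_congr rfl fun i _ => ?_
  rw [Finset.sum_comm]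
  refine Finset.sum_congr rfl fun j _ => ?_
  rw [Finset.sum_comm]

/-- Cauchy-Schwarz for the positive semidefinite form `(S, T) ↦ Tr[S^* T ρ]`. -/
theorem norm_trace_mul_sq_le {ι : Type*} [Fintype ι] {ρ : Matrix ι ι ℂ} (hρ : ρ.PosSemidef)
    (S T : Matrix ι ι ℂ) :
    ‖(Sᴴ * T * ρ).trace‖ ^ 2 ≤ (Sᴴ * S * ρ).trace.re * (Tᴴ * T * ρ).trace.re := by
  let := Matrix.toMatrixSeminormedAddCommGroup ρ hρ
  let := Matrix.toMatrixInnerProductSpace ρ hρ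
  have key (U V : Matrix ι ι ℂ) : inner ℂ U V = (Uᴴ * V * ρ).trace := by
    change (V * ρ * Uᴴ).trace = _
    rw [Matrix.trace_mul_comm, Matrix.mul_assoc]
  have h := inner_mul_inner_self_le (𝕜 := ℂ) S T
  rw [norm_inner_symm T S, key, key, key] at h
  simpa [sq] using h

theorem trace_kronecker_one_mul [DecidableEq B] (ρ : Matrix (A × B) (A × B) ℂ)
    (X : Matrix A A ℂ) : ((X ⊗ₖ (1 : Matrix B B ℂ)) * ρ).trace = (X * margA ρ).trace := by
  simp only [Matrix.trace, Matrix.diag, Matrix.mul_apply, Fintype.sum_prod_type,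
    kroneckerMap_apply, margA, Matrix.of_apply, Finset.mul_sum]
  refine Finset.sum_congr rfl fun i _ => ?_
  rw [Finset.sum_comm]
  refine Finset.sum_congr rfl fun j _ => Finset.sum_congr rfl fun k _ => ?_
  simp [Matrix.one_apply]

theorem trace_one_kronecker_mul [DecidableEq A] (ρ : Matrix (A × B) (A × B) ℂ)
    (Y : Matrix B B ℂ) : (((1 : Matrix A A ℂ) ⊗ₖ Y) * ρ).trace = (Y * margB ρ).trace := by
  simp only [Matrix.trace, Matrix.diag, Matrix.mul_apply, Fintype.sum_prod_type,
    kroneckerMap_apply, margB, Matrix.of_apply, Finset.mul_sum]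
  have (i : A) (k : B) : ∑ j, ∑ l, (1 : Matrix A A ℂ) i j * Y k l * ρ (j, l) (i, k) =
      ∑ l, Y k l * ρ (i, l) (i, k) := by
    rw [Finset.sum_comm]
    simp [Matrix.one_apply]
  simp only [this]
  rw [Finset.sum_comm]
  exact Finset.sum_congr rfl fun k _ => Finset.sum_comm

theorem corr_conjTranspose {ρ : Matrix (A × B) (A × B) ℂ} (hρ : ρ.IsHermitian)
    (X : Matrix A A ℂ) (Y : Matrix B B ℂ) :
    corr ρ Xᴴ Yᴴ = star (corr ρ X Y) := by
  rw [corr, corr, ← Matrix.trace_conjTranspose, conjTranspose_mul, conjTranspose_kronecker,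
    hρ.eq, Matrix.trace_mul_comm]

theorem wsq_conjTranspose (w : A → A → ℝ) (X : Matrix A A ℂ) :
    wsq w Xᴴ = wsq (fun i j => w j i) X := by
  rw [wsq, wsq, Finset.sum_comm]
  simp

variable [DecidableEq A] [DecidableEq B]

/-- The bipartite matrix `ρ` is positive semidefinite and its marginals are the diagonal matrices
with entries `a` and `b`. -/
structure DiagMarginals (ρ : Matrix (A × B) (A × B) ℂ) (a : A → ℝ) (b : B → ℝ) : Prop where
  posSemidef : ρ.PosSemidef
  margA_eq : margA ρ = Matrix.diagonal fun i => (a i : ℂ)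
  margB_eq : margB ρ = Matrix.diagonal fun i => (b i : ℂ)

theorem trace_conjTranspose_mul_self_mul_diagonal (a : A → ℝ) (X : Matrix A A ℂ) :
    (Xᴴ * X * Matrix.diagonal fun i => (a i : ℂ)).trace.re = wsq (fun _ j => a j) X := by
  simp only [Matrix.trace, Matrix.diag_apply, Matrix.mul_diagonal]
  simp only [Matrix.mul_apply, conjTranspose_apply, Complex.re_sum, wsq, Finset.sum_mul]
  rw [Finset.sum_comm]
  refine Finset.sum_congr rfl fun i _ => Finset.sum_congr rfl fun j _ => ?_
  rw [Complex.star_def, Complex.conj_mul']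
  norm_cast

variable {ρ : Matrix (A × B) (A × B) ℂ} {a : A → ℝ} {b : B → ℝ}

/-- At the endpoint `k = 0` the weighted norms are `Tr[X^* X σ]`, and the bound is the
Cauchy-Schwarz inequality for `1 ⊗ Y` and `X ⊗ 1`. -/
theorem DiagMarginals.norm_corr_sq_le_right (h : DiagMarginals ρ a b) (X : Matrix A A ℂ)
    (Y : Matrix B B ℂ) :
    ‖corr ρ X Y‖ ^ 2 ≤ wsq (fun _ j => a j) X * wsq (fun _ l => b l) Y := by
  have := norm_trace_mul_sq_le h.posSemidef ((1 : Matrix A A ℂ) ⊗ₖ Y) (X ⊗ₖ (1 : Matrix B B ℂ))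
  simp only [conjTranspose_kronecker, ← mul_kronecker_mul, conjTranspose_one, Matrix.one_mul,
    Matrix.mul_one, trace_kronecker_one_mul, trace_one_kronecker_mul, h.margA_eq, h.margB_eq,
    trace_conjTranspose_mul_self_mul_diagonal] at this
  rwa [mul_comm (wsq _ X)]

/-- At the endpoint `k = 1` the weighted norms are `Tr[X X^* σ]`, so the bound is the one at
`k = 0` for the adjoint operators. -/
theorem DiagMarginals.norm_corr_sq_le_left (h : DiagMarginals ρ a b) (X : Matrix A A ℂ)
    (Y : Matrix B B ℂ) :
    ‖corr ρ X Y‖ ^ 2 ≤ wsq (fun i _ => a i) X * wsq (fun k _ => b k) Y := by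
  have := h.norm_corr_sq_le_right Xᴴ Yᴴ
  rwa [corr_conjTranspose h.posSemidef.isHermitian, norm_star, wsq_conjTranspose,
    wsq_conjTranspose] at this

end

/-! ### Interpolation between the two endpoints -/

/-- The weights `a_i^k a_j^(1-k)` of the inner product belonging to `f_k` in an eigenbasis of a
state with eigenvalues `a`. -/
def powWeight {A : Type*} (k : ℝ) (a : A → ℝ) (i j : A) : ℝ :=
  a i ^ k * a j ^ (1 - k)

/-- `σ^(-s) X σ^s` for `σ` diagonal with entries `a`, with `log 0` read as `0`. -/
def twist {A : Type*} (a : A → ℝ) (X : Matrix A A ℂ) (s : ℂ) : Matrix A A ℂ :=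
  Matrix.of fun i j => X i j * Complex.exp (s * (Real.log (a j) - Real.log (a i) : ℝ))

theorem twist_zero {A : Type*} (a : A → ℝ) (X : Matrix A A ℂ) : twist a X 0 = X := by
  ext
  simp [twist]

theorem wsq_nonneg {A : Type*} [Fintype A] {w : A → A → ℝ} (hw : ∀ i j, 0 ≤ w i j)
    (X : Matrix A A ℂ) : 0 ≤ wsq w X :=
  Finset.sum_nonneg fun i _ => Finset.sum_nonneg fun j _ => mul_nonneg (sq_nonneg _) (hw i j)

theorem powWeight_nonneg {A : Type*} {a : A → ℝ} (ha : ∀ i, 0 ≤ a i) (k : ℝ) (i j : A) :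
    0 ≤ powWeight k a i j :=
  mul_nonneg (Real.rpow_nonneg (ha i) _) (Real.rpow_nonneg (ha j) _)

section
variable {A B : Type*} [Fintype A] [Fintype B]

theorem norm_twist_sq {A : Type*} (a : A → ℝ) (X : Matrix A A ℂ) (s : ℂ) (i j : A) :
    ‖twist a X s i j‖ ^ 2 =
      ‖X i j‖ ^ 2 * Real.exp (2 * s.re * (Real.log (a j) - Real.log (a i))) := by
  rw [twist, Matrix.of_apply, norm_mul, mul_pow, Complex.norm_exp, ← Real.exp_nat_mul]
  congr 2
  rw [Complex.re_mul_ofReal]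
  push_cast
  ring

/-- On the left edge of the strip the twist turns the weights of `f_k` into those at `k = 0`. -/
theorem wsq_twist_left {a : A → ℝ} (ha : ∀ i, 0 ≤ a i) {X : Matrix A A ℂ}
    (hX : ∀ i j, a i = 0 ∨ a j = 0 → X i j = 0) {k : ℝ} {s : ℂ} (hs : s.re = -k / 2) :
    wsq (fun _ j => a j) (twist a X s) = wsq (powWeight k a) X := by
  refine Finset.sum_congr rfl fun i _ => Finset.sum_congr rfl fun j _ => ?_
  rw [norm_twist_sq]
  by_cases h : a i = 0 ∨ a j = 0
  · simp [hX i j h]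
  · push Not at h
    have hi := (ha i).lt_of_ne' h.1
    have hj := (ha j).lt_of_ne' h.2
    rw [mul_assoc, powWeight, Real.rpow_def_of_pos hi, Real.rpow_def_of_pos hj, hs]
    congr 1
    refine Eq.trans (congrArg _ (Real.exp_log hj).symm) ?_
    rw [← Real.exp_add, ← Real.exp_add]
    ring_nf

/-- On the right edge of the strip the twist turns the weights of `f_k` into those at `k = 1`. -/
theorem wsq_twist_right {a : A → ℝ} (ha : ∀ i, 0 ≤ a i) {X : Matrix A A ℂ}
    (hX : ∀ i j, a i = 0 ∨ a j = 0 → X i j = 0) {k : ℝ} {s : ℂ} (hs : s.re = (1 - k) / 2) :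
    wsq (fun i _ => a i) (twist a X s) = wsq (powWeight k a) X := by
  refine Finset.sum_congr rfl fun i _ => Finset.sum_congr rfl fun j _ => ?_
  rw [norm_twist_sq]
  by_cases h : a i = 0 ∨ a j = 0
  · simp [hX i j h]
  · push Not at h
    have hi := (ha i).lt_of_ne' h.1
    have hj := (ha j).lt_of_ne' h.2
    rw [mul_assoc, powWeight, Real.rpow_def_of_pos hi, Real.rpow_def_of_pos hj, hs]
    congr 1
    refine Eq.trans (congrArg _ (Real.exp_log hi).symm) ?_
    rw [← Real.exp_add, ← Real.exp_add]
    ring_nf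

/-- The part of `X` on the support of the weights `a`. -/
def cutoff {A : Type*} (a : A → ℝ) (X : Matrix A A ℂ) : Matrix A A ℂ :=
  open Classical in Matrix.of fun i j => if a i = 0 ∨ a j = 0 then 0 else X i j

theorem wsq_cutoff_le {a : A → ℝ} (ha : ∀ i, 0 ≤ a i) (k : ℝ) (X : Matrix A A ℂ) :
    wsq (powWeight k a) (cutoff a X) ≤ wsq (powWeight k a) X := by
  refine Finset.sum_le_sum fun i _ => Finset.sum_le_sum fun j _ =>
    mul_le_mul_of_nonneg_right ?_ (powWeight_nonneg ha k i j)
  simp only [cutoff, Matrix.of_apply]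
  split_ifs
  · simp
  · exact le_rfl

variable {ρ : Matrix (A × B) (A × B) ℂ}

/-- The correlation of the twisted operators is an exponential polynomial in `s`. The conjugate in
the second argument cancels the conjugate-linearity of the form there. -/
theorem corr_twist (ρ : Matrix (A × B) (A × B) ℂ) (a : A → ℝ) (b : B → ℝ) (X : Matrix A A ℂ)
    (Y : Matrix B B ℂ) (s : ℂ) :
    corr ρ (twist a X s) (twist b Y (star s)) = ∑ i, ∑ j, ∑ k, ∑ l,
      (X i j * star (Y k l) * ρ (j, k) (i, l)) * Complex.exp (s * ((Real.log (a j) -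
        Real.log (a i) + (Real.log (b l) - Real.log (b k)) : ℝ) : ℂ)) := by
  rw [corr_eq_sum]
  refine Finset.sum_congr rfl fun i _ => Finset.sum_congr rfl fun j _ =>
    Finset.sum_congr rfl fun k _ => Finset.sum_congr rfl fun l _ => ?_
  simp only [twist, Matrix.of_apply, star_mul', Complex.star_def, ← Complex.exp_conj, map_mul,
    Complex.conj_conj, Complex.conj_ofReal, Complex.ofReal_add, mul_add, Complex.exp_add]
  ring

theorem isBigO_exp_mul_strip (r : ℝ) {x y : ℝ} :
    (fun s : ℂ => Complex.exp (s * (r : ℂ))) =O[𝓟 (Complex.re ⁻¹' Set.Ioo x y)]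
      fun _ => (1 : ℝ) := by
  refine Asymptotics.IsBigO.of_bound (Real.exp ((|x| + |y|) * |r|)) ?_
  rw [eventually_principal]
  rintro s ⟨h1, h2⟩
  rw [Complex.norm_exp, norm_one, mul_one, Complex.re_mul_ofReal]
  refine Real.exp_le_exp.2 ((le_abs_self _).trans ?_)
  rw [abs_mul]
  gcongr
  rw [abs_le]
  constructor <;>
    linarith [neg_abs_le x, neg_abs_le y, le_abs_self x, le_abs_self y, abs_nonneg x, abs_nonneg y]

variable [DecidableEq A] [DecidableEq B] {a : A → ℝ} {b : B → ℝ}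

/-- For operators living on the supports of the marginals, the correlation of the twisted operators
is holomorphic and bounded on a strip of width `1/2`, the endpoint inequalities hold on its two
edges, and the value at `0` is the correlation of `X` and `Y`. -/
theorem DiagMarginals.norm_corr_le_of_support (h : DiagMarginals ρ a b) (ha : ∀ i, 0 ≤ a i)
    (hb : ∀ i, 0 ≤ b i) {k : ℝ} (hk0 : 0 ≤ k) (hk1 : k ≤ 1) {X : Matrix A A ℂ}
    {Y : Matrix B B ℂ} (hX : ∀ i j, a i = 0 ∨ a j = 0 → X i j = 0)
    (hY : ∀ i j, b i = 0 ∨ b j = 0 → Y i j = 0) :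
    ‖corr ρ X Y‖ ≤ √(wsq (powWeight k a) X * wsq (powWeight k b) Y) := by
  have key := PhragmenLindelof.vertical_strip (a := -k / 2) (b := (1 - k) / 2) (z := 0)
    (f := fun s => corr ρ (twist a X s) (twist b Y (star s)))
    (C := √(wsq (powWeight k a) X * wsq (powWeight k b) Y)) ?_ ?_ ?_ ?_ ?_ ?_
  · simpa [twist_zero] using key
  · simp only [corr_twist]
    exact Differentiable.diffContOnCl (by fun_prop)
  -- The function is bounded on the strip, so the growth condition holds with both constants zero.
  · refine ⟨0, ?_, 0, ?_⟩
    · have : (1 - k) / 2 - -k / 2 = 1 / 2 := by ring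
      rw [this]
      positivity
    · simp only [corr_twist, zero_mul, Real.exp_zero]
      refine Asymptotics.IsBigO.mono ?_ inf_le_right
      refine Asymptotics.IsBigO.fun_sum fun i _ => Asymptotics.IsBigO.fun_sum fun j _ =>
        Asymptotics.IsBigO.fun_sum fun k _ => Asymptotics.IsBigO.fun_sum fun l _ =>
        (isBigO_exp_mul_strip _).const_mul_left _
  · intro s hs
    refine Real.le_sqrt_of_sq_le ?_
    have := h.norm_corr_sq_le_right (twist a X s) (twist b Y (star s))
    rwa [wsq_twist_left ha hX hs, wsq_twist_left hb hY (by simpa using hs)] at this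
  · intro s hs
    refine Real.le_sqrt_of_sq_le ?_
    have := h.norm_corr_sq_le_left (twist a X s) (twist b Y (star s))
    rwa [wsq_twist_right ha hX hs, wsq_twist_right hb hY (by simpa using hs)] at this
  · simp only [Complex.zero_re]
    linarith
  · simp only [Complex.zero_re]
    linarith

theorem wsq_single {A : Type*} [Fintype A] [DecidableEq A] (w : A → A → ℝ) (i j : A) :
    wsq w (Matrix.single i j 1) = w i j := by
  simp [wsq, Matrix.single_apply, ite_and, apply_ite norm]

theorem corr_single (ρ : Matrix (A × B) (A × B) ℂ) (i j : A) (k l : B) :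
    corr ρ (Matrix.single i j 1) (Matrix.single k l 1) = ρ (j, k) (i, l) := by
  rw [corr_eq_sum]
  simp [Matrix.single_apply, ite_and, Finset.sum_ite_eq, apply_ite star]

/-- A bipartite positive matrix is supported in the tensor product of the supports of its
marginals (first factor). -/
theorem DiagMarginals.apply_eq_zero_left (h : DiagMarginals ρ a b) {i j : A}
    (hij : a i = 0 ∨ a j = 0) (k l : B) : ρ (j, k) (i, l) = 0 := by
  rw [← corr_single ρ]
  rcases hij with h0 | h0
  · have := h.norm_corr_sq_le_left (Matrix.single i j 1) (Matrix.single k l 1)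
    rw [wsq_single, h0, zero_mul] at this
    exact norm_eq_zero.1 (pow_eq_zero_iff two_ne_zero |>.1 (this.antisymm (sq_nonneg _)))
  · have := h.norm_corr_sq_le_right (Matrix.single i j 1) (Matrix.single k l 1)
    rw [wsq_single, h0, zero_mul] at this
    exact norm_eq_zero.1 (pow_eq_zero_iff two_ne_zero |>.1 (this.antisymm (sq_nonneg _)))

/-- A bipartite positive matrix is supported in the tensor product of the supports of its
marginals (second factor). -/
theorem DiagMarginals.apply_eq_zero_right (h : DiagMarginals ρ a b) {k l : B}
    (hkl : b k = 0 ∨ b l = 0) (i j : A) : ρ (j, k) (i, l) = 0 := by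
  rw [← corr_single ρ]
  rcases hkl with h0 | h0
  · have := h.norm_corr_sq_le_left (Matrix.single i j 1) (Matrix.single k l 1)
    rw [wsq_single, wsq_single, h0, mul_zero] at this
    exact norm_eq_zero.1 (pow_eq_zero_iff two_ne_zero |>.1 (this.antisymm (sq_nonneg _)))
  · have := h.norm_corr_sq_le_right (Matrix.single i j 1) (Matrix.single k l 1)
    rw [wsq_single, wsq_single, h0, mul_zero] at this
    exact norm_eq_zero.1 (pow_eq_zero_iff two_ne_zero |>.1 (this.antisymm (sq_nonneg _)))

theorem DiagMarginals.corr_cutoff (h : DiagMarginals ρ a b) (X : Matrix A A ℂ)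
    (Y : Matrix B B ℂ) : corr ρ (cutoff a X) (cutoff b Y) = corr ρ X Y := by
  rw [corr_eq_sum, corr_eq_sum]
  refine Finset.sum_congr rfl fun i _ => Finset.sum_congr rfl fun j _ =>
    Finset.sum_congr rfl fun k _ => Finset.sum_congr rfl fun l _ => ?_
  by_cases h1 : a i = 0 ∨ a j = 0
  · simp [h.apply_eq_zero_left h1]
  by_cases h2 : b k = 0 ∨ b l = 0
  · simp [h.apply_eq_zero_right h2]
  simp [cutoff, h1, h2]

/-- The correlation form is a contraction for the inner products belonging to `f_k`. The two
endpoints `k = 0` and `k = 1` are Cauchy-Schwarz inequalities; the values in between follow from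
the Phragmen-Lindelof principle on a vertical strip. -/
theorem DiagMarginals.norm_corr_le (h : DiagMarginals ρ a b) (ha : ∀ i, 0 ≤ a i)
    (hb : ∀ i, 0 ≤ b i) {k : ℝ} (hk0 : 0 ≤ k) (hk1 : k ≤ 1) (X : Matrix A A ℂ)
    (Y : Matrix B B ℂ) :
    ‖corr ρ X Y‖ ≤ √(wsq (powWeight k a) X * wsq (powWeight k b) Y) := by
  rw [← h.corr_cutoff]
  refine (h.norm_corr_le_of_support ha hb hk0 hk1 (fun i j hij => by simp [cutoff, hij])
    fun i j hij => by simp [cutoff, hij]).trans (Real.sqrt_le_sqrt ?_)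
  exact mul_le_mul (wsq_cutoff_le ha k X) (wsq_cutoff_le hb k Y)
    (wsq_nonneg (powWeight_nonneg hb k) _) (wsq_nonneg (powWeight_nonneg ha k) _)

end

/-! ### Tensor powers and spectral gaps -/

/-- The `n`-fold tensor power of a matrix. -/
def tpow {I J : Type*} (M : Matrix I J ℂ) (n : ℕ) : Matrix (Fin n → I) (Fin n → J) ℂ :=
  Matrix.of fun x y => ∏ t, M (x t) (y t)

section
variable {I J K : Type*}

theorem tpow_mul [Fintype J] (M : Matrix I J ℂ) (N : Matrix J K ℂ) (n : ℕ) :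
    tpow (M * N) n = tpow M n * tpow N n := by
  ext x y
  simp only [tpow, Matrix.of_apply, Matrix.mul_apply, ← Finset.prod_mul_distrib]
  rw [Finset.prod_univ_sum, Fintype.piFinset_univ]

theorem tpow_conjTranspose (M : Matrix I J ℂ) (n : ℕ) : tpow Mᴴ n = (tpow M n)ᴴ := by
  ext x y
  simp [tpow]

theorem tpow_one [DecidableEq I] (n : ℕ) : tpow (1 : Matrix I I ℂ) n = 1 := by
  ext x y
  simp [tpow, Matrix.one_apply, Finset.prod_ite_zero, funext_iff]

theorem tpow_zero [DecidableEq I] (M : Matrix I I ℂ) : tpow M 0 = 1 := by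
  ext x y
  simp [tpow, Matrix.one_apply, Subsingleton.elim x y]

theorem tpow_succ (M : Matrix I I ℂ) (n : ℕ) :
    tpow M (n + 1) = (M ⊗ₖ tpow M n).submatrix (fun x => (x 0, Fin.tail x))
      (fun x => (x 0, Fin.tail x)) := by
  ext x y
  simp [tpow, Fin.prod_univ_succ, Fin.tail]

theorem tpow_vecMulVec (u v : I → ℂ) (n : ℕ) :
    tpow (vecMulVec u v) n = vecMulVec (fun x => ∏ t, u (x t)) (fun x => ∏ t, v (x t)) := by
  ext x y
  simp [tpow, vecMulVec_apply, Finset.prod_mul_distrib]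

theorem star_dotProduct_self [Fintype I] (x : I → ℂ) :
    star x ⬝ᵥ x = ((∑ i, ‖x i‖ ^ 2 : ℝ) : ℂ) := by
  simp only [dotProduct, Pi.star_apply, Complex.star_def, Complex.conj_mul']
  push_cast
  rfl

theorem norm_star_dotProduct_sq_le [Fintype I] (x y : I → ℂ) :
    ‖star x ⬝ᵥ y‖ ^ 2 ≤ (∑ i, ‖x i‖ ^ 2) * ∑ i, ‖y i‖ ^ 2 := by
  calc ‖star x ⬝ᵥ y‖ ^ 2 ≤ (∑ i, ‖x i‖ * ‖y i‖) ^ 2 := by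
        gcongr
        refine (norm_sum_le _ _).trans_eq ?_
        simp
    _ ≤ _ := Finset.sum_mul_sq_le_sq_mul_sq _ _ _

theorem posSemidef_of_isHermitian_of_mul_self [Fintype I] {P : Matrix I I ℂ} (hP : P.IsHermitian)
    (hPP : P * P = P) : P.PosSemidef := by
  have := posSemidef_conjTranspose_mul_self P
  rwa [hP.eq, hPP] at this

theorem posSemidef_one_sub_of_mul_self [Fintype I] [DecidableEq I] {P : Matrix I I ℂ}
    (hP : P.IsHermitian) (hPP : P * P = P) : (1 - P).PosSemidef :=
  posSemidef_of_isHermitian_of_mul_self (isHermitian_one.sub hP) (by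
    rw [Matrix.mul_sub, Matrix.sub_mul, Matrix.sub_mul, hPP]
    simp)

/-- The bound `Mᴴ M ≤ P + s² (1 - P)`, with `P` a projection, is inherited by tensor powers: the
part of the spectrum outside the range of `P^{⊗ n}` consists of products with at least one factor
that is at most `s²`. -/
theorem posSemidef_gap_tpow [Fintype I] [Fintype J] [DecidableEq J] {M : Matrix I J ℂ}
    {P : Matrix J J ℂ} (hP : P.IsHermitian) (hPP : P * P = P) {c : ℝ} (hc0 : 0 ≤ c) (hc1 : c ≤ 1)
    (h : ((P + (c : ℂ) • (1 - P)) - Mᴴ * M).PosSemidef) (n : ℕ) :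
    ((tpow P n + (c : ℂ) • (1 - tpow P n)) - (tpow M n)ᴴ * tpow M n).PosSemidef := by
  have hc0' : (0 : ℂ) ≤ (c : ℂ) := by exact_mod_cast hc0
  have hc1' : (0 : ℂ) ≤ ((1 - c : ℝ) : ℂ) := by
    exact_mod_cast sub_nonneg.2 hc1
  rw [← tpow_conjTranspose, ← tpow_mul]
  induction n with
  | zero => simpa [tpow_zero] using PosSemidef.zero
  | succ n ih =>
    have hPn : (tpow P n).IsHermitian := by rw [IsHermitian, ← tpow_conjTranspose, hP.eq]
    have hPPn : tpow P n * tpow P n = tpow P n := by rw [← tpow_mul, hPP]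
    have hK : (tpow (Mᴴ * M) n).PosSemidef := by
      rw [tpow_mul, tpow_conjTranspose]
      exact posSemidef_conjTranspose_mul_self _
    have hG : (P + (c : ℂ) • (1 - P)).PosSemidef :=
      (posSemidef_of_isHermitian_of_mul_self hP hPP).add
        ((posSemidef_one_sub_of_mul_self hP hPP).smul hc0')
    -- `P ⊗ Pₙ + c (1 - P ⊗ Pₙ)` exceeds `(P + c (1 - P)) ⊗ (Pₙ + c (1 - Pₙ))` by
    -- `c (1 - c) (1 - P) ⊗ (1 - Pₙ)`.
    have key := ((hG.kronecker ih).add (h.kronecker hK)).add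
      ((((posSemidef_one_sub_of_mul_self hP hPP).kronecker
        (posSemidef_one_sub_of_mul_self hPn hPPn)).smul hc1').smul hc0')
    have := key.submatrix fun x : Fin (n + 1) → J => (x 0, Fin.tail x)
    rw [tpow_succ P, tpow_succ (Mᴴ * M)]
    refine (iff_of_eq (congrArg Matrix.PosSemidef ?_)).2 this
    ext x y
    have h1 : (1 : Matrix (Fin (n + 1) → J) (Fin (n + 1) → J) ℂ) x y =
        (1 : Matrix J J ℂ) (x 0) (y 0) * (1 : Matrix _ _ ℂ) (Fin.tail x) (Fin.tail y) := by
      rw [← tpow_one, tpow_succ, tpow_one]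
      rfl
    simp only [Matrix.sub_apply, Matrix.add_apply, Matrix.smul_apply, Matrix.submatrix_apply,
      kroneckerMap_apply, smul_eq_mul, h1]
    push_cast
    ring

/-- If `M` maps the unit vector `u` to the unit vector `v`, its adjoint maps `v` to `u`, and the
form of `M` is bounded by `s` on the orthogonal complements, then `Mᴴ M ≤ uuᴴ + s² (1 - uuᴴ)`. -/
theorem posSemidef_gap_of_bound [Fintype I] [Fintype J] [DecidableEq J] {M : Matrix I J ℂ}
    {u : J → ℂ} {v : I → ℂ} (hu : star u ⬝ᵥ u = 1) (hMu : M *ᵥ u = v) (hMv : Mᴴ *ᵥ v = u)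
    {s : ℝ} (hM : ∀ x y, star v ⬝ᵥ x = 0 → star u ⬝ᵥ y = 0 →
      ‖star x ⬝ᵥ (M *ᵥ y)‖ ≤ s * √((∑ i, ‖x i‖ ^ 2) * ∑ j, ‖y j‖ ^ 2)) :
    ((vecMulVec u (star u) + ((s ^ 2 : ℝ) : ℂ) • (1 - vecMulVec u (star u))) -
      Mᴴ * M).PosSemidef := by
  set P := vecMulVec u (star u) with hPdef
  have hP : P.IsHermitian := by
    rw [IsHermitian, hPdef, conjTranspose_vecMulVec, star_star]
  have hPu (y : J → ℂ) : P *ᵥ y = (star u ⬝ᵥ y) • u := by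
    rw [hPdef, vecMulVec_mulVec]
    ext i
    simp [mul_comm]
  have hPP : P * P = P := by
    rw [hPdef, vecMulVec_mul_vecMulVec, hu]
    simp
  have hKP : Mᴴ * M * P = P := by
    rw [hPdef, mul_vecMulVec, ← mulVec_mulVec, hMu, hMv]
  have hPK : P * (Mᴴ * M) = P := by
    have := congrArg conjTranspose hKP
    rwa [conjTranspose_mul, conjTranspose_mul, conjTranspose_conjTranspose, hP.eq] at this
  -- Since `Mᴴ M` fixes `u`, only the compression to the orthogonal complement of `u` matters.
  have hfact : P + ((s ^ 2 : ℝ) : ℂ) • (1 - P) - Mᴴ * M =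
      (1 - P)ᴴ * (((s ^ 2 : ℝ) : ℂ) • 1 - Mᴴ * M) * (1 - P) := by
    rw [(isHermitian_one.sub hP).eq]
    have e1 : (1 - P) * (((s ^ 2 : ℝ) : ℂ) • 1 - Mᴴ * M) =
        ((s ^ 2 : ℝ) : ℂ) • (1 - P) - (Mᴴ * M - P) := by
      rw [Matrix.mul_sub, Matrix.mul_smul, Matrix.mul_one, Matrix.sub_mul, Matrix.one_mul, hPK]
    have e2 : (1 - P) * (1 - P) = 1 - P := by
      rw [Matrix.mul_sub, Matrix.sub_mul, Matrix.sub_mul, hPP]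
      simp
    have e3 : (Mᴴ * M - P) * (1 - P) = Mᴴ * M - P := by
      rw [Matrix.mul_sub, Matrix.mul_one, Matrix.sub_mul, hKP, hPP]
      simp
    rw [e1, Matrix.sub_mul, Matrix.smul_mul, e2, e3]
    abel
  have hH : (P + ((s ^ 2 : ℝ) : ℂ) • (1 - P) - Mᴴ * M).IsHermitian := by
    refine (hP.add ?_).sub (isHermitian_conjTranspose_mul_self M)
    rw [IsHermitian, conjTranspose_smul, (isHermitian_one.sub hP).eq, Complex.star_def,
      Complex.conj_ofReal]
  refine PosSemidef.of_dotProduct_mulVec_nonneg hH fun y => ?_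
  set z := (1 - P) *ᵥ y with hz
  have hzu : star u ⬝ᵥ z = 0 := by
    rw [hz, sub_mulVec, one_mulVec, hPu, dotProduct_sub, dotProduct_smul, hu]
    simp
  have hvz : star v ⬝ᵥ (M *ᵥ z) = 0 := by
    rw [dotProduct_mulVec, ← conjTranspose_conjTranspose M, ← star_mulVec, hMv, hzu]
  -- `M z` is orthogonal to `v`, so it may be tested against itself.
  have hb := hM (M *ᵥ z) z hvz hzu
  have hq : star y ⬝ᵥ ((P + ((s ^ 2 : ℝ) : ℂ) • (1 - P) - Mᴴ * M) *ᵥ y) =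
      ((s ^ 2 * ∑ j, ‖z j‖ ^ 2 - ∑ i, ‖(M *ᵥ z) i‖ ^ 2 : ℝ) : ℂ) := by
    rw [hfact, ← mulVec_mulVec, ← mulVec_mulVec, dotProduct_mulVec, ← star_mulVec, ← hz,
      sub_mulVec, smul_mulVec, one_mulVec, dotProduct_sub, dotProduct_smul, ← mulVec_mulVec,
      dotProduct_mulVec _ Mᴴ, ← star_mulVec, star_dotProduct_self, star_dotProduct_self]
    push_cast
    rfl
  rw [hq]
  rw [star_dotProduct_self, Complex.norm_real, Real.norm_of_nonneg (by positivity)] at hb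
  have hz0 : 0 ≤ ∑ j, ‖z j‖ ^ 2 := by positivity
  have hMz0 : 0 ≤ ∑ i, ‖(M *ᵥ z) i‖ ^ 2 := by positivity
  generalize ∑ j, ‖z j‖ ^ 2 = p at *
  generalize ∑ i, ‖(M *ᵥ z) i‖ ^ 2 = q at *
  have : q ≤ s ^ 2 * p := by
    rcases hMz0.eq_or_lt with h0 | h0
    · rw [← h0]
      positivity
    · have h2 : q ^ 2 ≤ (s * √(q * p)) ^ 2 := by gcongr
      rw [mul_pow, Real.sq_sqrt (by positivity)] at h2
      nlinarith
  exact_mod_cast sub_nonneg.2 this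

/-- The bound by `s` on the orthogonal complement of `u` passes to tensor powers. -/
theorem norm_dotProduct_tpow_le [Fintype I] [Fintype J] [DecidableEq J] {M : Matrix I J ℂ}
    {u : J → ℂ} (hu : star u ⬝ᵥ u = 1) {s : ℝ} (hs0 : 0 ≤ s) (hs1 : s ≤ 1)
    (h : ((vecMulVec u (star u) + ((s ^ 2 : ℝ) : ℂ) • (1 - vecMulVec u (star u))) -
      Mᴴ * M).PosSemidef) (n : ℕ) (x : (Fin n → I) → ℂ) (y : (Fin n → J) → ℂ)
    (hy : (star fun p : Fin n → J => ∏ t, u (p t)) ⬝ᵥ y = 0) :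
    ‖star x ⬝ᵥ (tpow M n *ᵥ y)‖ ≤ s * √((∑ i, ‖x i‖ ^ 2) * ∑ j, ‖y j‖ ^ 2) := by
  have hP : (vecMulVec u (star u)).IsHermitian := by
    rw [IsHermitian, conjTranspose_vecMulVec, star_star]
  have hPP : vecMulVec u (star u) * vecMulVec u (star u) = vecMulVec u (star u) := by
    rw [vecMulVec_mul_vecMulVec, hu]
    simp
  have hgap := (posSemidef_gap_tpow hP hPP (sq_nonneg s) (pow_le_one₀ hs0 hs1) h
    n).dotProduct_mulVec_nonneg y
  have hPy : tpow (vecMulVec u (star u)) n *ᵥ y = 0 := by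
    rw [tpow_vecMulVec, vecMulVec_mulVec]
    have : (fun p : Fin n → J => ∏ t, (star u) (p t)) = star fun p => ∏ t, u (p t) := by
      ext p
      simp
    rw [this, hy]
    simp
  rw [sub_mulVec, add_mulVec, smul_mulVec, sub_mulVec, one_mulVec, hPy, zero_add, sub_zero,
    dotProduct_sub, dotProduct_smul, ← mulVec_mulVec, dotProduct_mulVec _ (tpow M n)ᴴ,
    ← star_mulVec, star_dotProduct_self, star_dotProduct_self, smul_eq_mul, ← Complex.ofReal_mul,
    ← Complex.ofReal_sub] at hgap
  have hgap' : 0 ≤ s ^ 2 * ∑ j, ‖y j‖ ^ 2 - ∑ i, ‖(tpow M n *ᵥ y) i‖ ^ 2 := by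
    exact_mod_cast hgap
  have h2 := norm_star_dotProduct_sq_le x (tpow M n *ᵥ y)
  refine abs_le_of_sq_le_sq' ?_ (by positivity) |>.2
  rw [mul_pow, Real.sq_sqrt (by positivity)]
  have hx0 : 0 ≤ ∑ i, ‖x i‖ ^ 2 := by positivity
  nlinarith [mul_nonneg hx0 hgap']

end

/-! ### Tensorization of the bound on mean-zero operators -/

/-- The matrix of the correlation form in the orthonormal coordinates `√w_ij X_ij` of the weighted
Hilbert-Schmidt spaces. Directions of zero weight receive the coefficient `0⁻¹ = 0`. -/
def normMat {A B : Type*} (k : ℝ) (a : A → ℝ) (b : B → ℝ) (ρ : Matrix (A × B) (A × B) ℂ) :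
    Matrix (B × B) (A × A) ℂ :=
  Matrix.of fun q p => ρ (p.2, q.1) (p.1, q.2) *
    (((√(powWeight k b q.1 q.2))⁻¹ : ℝ) * ((√(powWeight k a p.1 p.2))⁻¹ : ℝ))

/-- The operator with orthonormal coordinates `x`. -/
def ofCoord {A : Type*} (k : ℝ) (a : A → ℝ) (x : A × A → ℂ) : Matrix A A ℂ :=
  Matrix.of fun i j => x (i, j) * ((√(powWeight k a i j))⁻¹ : ℝ)

/-- The coordinates of the identity: the unit vector spanning the complement of the mean-zero
operators. -/
def diagVec {A : Type*} [DecidableEq A] (a : A → ℝ) (p : A × A) : ℂ :=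
  if p.1 = p.2 then (√(a p.1) : ℂ) else 0

theorem powWeight_self {A : Type*} {a : A → ℝ} (ha : ∀ i, 0 ≤ a i) {k : ℝ} (i : A) :
    powWeight k a i i = a i := by
  rw [powWeight, ← Real.rpow_add' (ha i) (by norm_num)]
  simp

theorem powWeight_pos {A : Type*} {a : A → ℝ} (ha : ∀ i, 0 ≤ a i) (k : ℝ) {i j : A}
    (h : ¬(a i = 0 ∨ a j = 0)) : 0 < powWeight k a i j := by
  push Not at h
  exact mul_pos (Real.rpow_pos_of_pos ((ha i).lt_of_ne' h.1) _)
    (Real.rpow_pos_of_pos ((ha j).lt_of_ne' h.2) _)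

theorem prod_powWeight {A : Type*} {a : A → ℝ} (ha : ∀ i, 0 ≤ a i) (k : ℝ) {n : ℕ}
    (i j : Fin n → A) :
    powWeight k (fun i : Fin n → A => ∏ t, a (i t)) i j = ∏ t, powWeight k a (i t) (j t) := by
  simp only [powWeight, Finset.prod_mul_distrib]
  rw [Real.finsetProd_rpow _ _ fun t _ => ha _, Real.finsetProd_rpow _ _ fun t _ => ha _]

section
variable {A B : Type*} [Fintype A] [Fintype B]

theorem star_dotProduct_normMat_mulVec (k : ℝ) (a : A → ℝ) (b : B → ℝ)
    (ρ : Matrix (A × B) (A × B) ℂ) (y : B × B → ℂ) (x : A × A → ℂ) :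
    star y ⬝ᵥ (normMat k a b ρ *ᵥ x) = corr ρ (ofCoord k a x) (ofCoord k b y) := by
  rw [corr_eq_sum]
  simp only [dotProduct, mulVec, Finset.mul_sum]
  rw [Finset.sum_comm]
  simp only [Fintype.sum_prod_type, normMat, ofCoord, Matrix.of_apply, Pi.star_apply, star_mul',
    Complex.star_def, Complex.conj_ofReal]
  refine Finset.sum_congr rfl fun i _ => Finset.sum_congr rfl fun j _ =>
    Finset.sum_congr rfl fun k _ => Finset.sum_congr rfl fun l _ => ?_
  ring

theorem wsq_ofCoord_le {a : A → ℝ} (ha : ∀ i, 0 ≤ a i) (k : ℝ) (x : A × A → ℂ) :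
    wsq (powWeight k a) (ofCoord k a x) ≤ ∑ p, ‖x p‖ ^ 2 := by
  rw [Fintype.sum_prod_type]
  refine Finset.sum_le_sum fun i _ => Finset.sum_le_sum fun j _ => ?_
  rw [ofCoord, Matrix.of_apply, norm_mul, mul_pow, mul_assoc, Complex.norm_real,
    Real.norm_eq_abs, sq_abs, inv_pow, Real.sq_sqrt (powWeight_nonneg ha k i j)]
  exact mul_le_of_le_one_right (sq_nonneg _) inv_mul_le_one

theorem sum_arrow_prod {M : Type*} [AddCommMonoid M] {n : ℕ} (f : (Fin n → A) → (Fin n → A) → M) :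
    ∑ p : Fin n → A × A, f (fun t => (p t).1) (fun t => (p t).2) = ∑ i, ∑ j, f i j := by
  rw [← Fintype.sum_prod_type' f]
  exact Fintype.sum_equiv (Equiv.arrowProdEquivProdArrow (Fin n) (fun _ => A) fun _ => A) _ _
    fun p => rfl

/-- The coordinates of an operator on `n` copies. -/
def toCoord {A : Type*} (k : ℝ) (a : A → ℝ) {n : ℕ} (X : Matrix (Fin n → A) (Fin n → A) ℂ)
    (p : Fin n → A × A) : ℂ :=
  (∏ t, (√(powWeight k a (p t).1 (p t).2) : ℂ)) * X (fun t => (p t).1) (fun t => (p t).2)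

theorem sum_norm_toCoord_sq {a : A → ℝ} (ha : ∀ i, 0 ≤ a i) (k : ℝ) {n : ℕ}
    (X : Matrix (Fin n → A) (Fin n → A) ℂ) :
    ∑ p, ‖toCoord k a X p‖ ^ 2 = wsq (powWeight k fun i : Fin n → A => ∏ t, a (i t)) X := by
  rw [wsq, ← sum_arrow_prod]
  refine Finset.sum_congr rfl fun p _ => ?_
  rw [prod_powWeight ha, toCoord, norm_mul, mul_pow, mul_comm, norm_prod, ← Finset.prod_pow]
  congr 1
  refine Finset.prod_congr rfl fun t _ => ?_
  rw [Complex.norm_real, Real.norm_eq_abs, sq_abs, Real.sq_sqrt (powWeight_nonneg ha k _ _)]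

variable [DecidableEq A] [DecidableEq B] {ρ : Matrix (A × B) (A × B) ℂ} {a : A → ℝ} {b : B → ℝ}

theorem star_diagVec_dotProduct_self (ha : ∀ i, 0 ≤ a i) (h1 : ∑ i, a i = 1) :
    star (diagVec a) ⬝ᵥ diagVec a = 1 := by
  rw [star_dotProduct_self, Fintype.sum_prod_type]
  norm_cast
  rw [← h1]
  refine Finset.sum_congr rfl fun i _ => ?_
  simp [diagVec, apply_ite norm, ite_pow, abs_of_nonneg (Real.sqrt_nonneg _),
    Real.sq_sqrt (ha i)]

theorem ofReal_mul_inv_sqrt {r : ℝ} (hr : 0 ≤ r) :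
    (r : ℂ) * ((√r)⁻¹ : ℝ) = (√r : ℝ) := by
  rw [← Complex.ofReal_mul]
  congr 1
  rcases hr.eq_or_lt with h | h
  · simp [← h]
  · rw [← div_eq_mul_inv, Real.div_sqrt]

theorem sum_mul_ofCoord (ha : ∀ i, 0 ≤ a i) (k : ℝ) (x : A × A → ℂ) :
    ∑ i, (a i : ℂ) * ofCoord k a x i i = star (diagVec a) ⬝ᵥ x := by
  simp only [dotProduct, Fintype.sum_prod_type]
  refine Finset.sum_congr rfl fun i _ => ?_
  simp only [ofCoord, Matrix.of_apply, powWeight_self ha, Pi.star_apply, diagVec]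
  rw [mul_left_comm, ofReal_mul_inv_sqrt (ha i)]
  simp [apply_ite star, mul_comm]

/-- The normalized form maps the unit vector of the identity on `A` to that on `B`: this is the
marginal condition for `B`. -/
theorem DiagMarginals.normMat_mulVec_diagVec (h : DiagMarginals ρ a b) (ha : ∀ i, 0 ≤ a i)
    (hb : ∀ i, 0 ≤ b i) (k : ℝ) : normMat k a b ρ *ᵥ diagVec a = diagVec b := by
  ext ⟨k', l⟩
  have h1 (i : A) : ρ (i, k') (i, l) * (((√(powWeight k b k' l))⁻¹ : ℝ) * ((√(a i))⁻¹ : ℝ)) *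
      (√(a i) : ℝ) = ρ (i, k') (i, l) * ((√(powWeight k b k' l))⁻¹ : ℝ) := by
    by_cases h0 : a i = 0
    · simp [h.apply_eq_zero_left (Or.inl h0)]
    · have : ((√(a i) : ℝ) : ℂ) ≠ 0 := by
        exact_mod_cast (Real.sqrt_pos.2 ((ha i).lt_of_ne' h0)).ne'
      rw [Complex.ofReal_inv (√(a i))]
      field_simp
  have h2 : ∑ i, ρ (i, k') (i, l) = diagonal (fun i => (b i : ℂ)) k' l := by
    rw [← h.margB_eq]
    rfl
  simp only [mulVec, dotProduct, Fintype.sum_prod_type, normMat, Matrix.of_apply, diagVec,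
    mul_ite, mul_zero, Finset.sum_ite_eq, Finset.mem_univ, if_true, powWeight_self ha, h1,
    ← Finset.sum_mul, h2, diagonal_apply]
  split_ifs with hkl
  · subst hkl
    rw [powWeight_self hb, ofReal_mul_inv_sqrt (hb _)]
  · simp

/-- The adjoint of the normalized form maps the unit vector of the identity on `B` to that on `A`:
this is the marginal condition for `A`. -/
theorem DiagMarginals.conjTranspose_normMat_mulVec_diagVec (h : DiagMarginals ρ a b)
    (ha : ∀ i, 0 ≤ a i) (hb : ∀ i, 0 ≤ b i) (k : ℝ) :
    (normMat k a b ρ)ᴴ *ᵥ diagVec b = diagVec a := by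
  ext ⟨i, j⟩
  have h1 (l : B) : ρ (i, l) (j, l) * (((√(b l))⁻¹ : ℝ) * ((√(powWeight k a i j))⁻¹ : ℝ)) *
      (√(b l) : ℝ) = ρ (i, l) (j, l) * ((√(powWeight k a i j))⁻¹ : ℝ) := by
    by_cases h0 : b l = 0
    · simp [h.apply_eq_zero_right (Or.inl h0)]
    · have : ((√(b l) : ℝ) : ℂ) ≠ 0 := by
        exact_mod_cast (Real.sqrt_pos.2 ((hb l).lt_of_ne' h0)).ne'
      rw [Complex.ofReal_inv (√(b l))]
      field_simp
  have h2 : ∑ l, ρ (i, l) (j, l) = diagonal (fun i => (a i : ℂ)) i j := by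
    rw [← h.margA_eq]
    rfl
  have h3 (p q : A × B) : (starRingEnd ℂ) (ρ p q) = ρ q p := h.posSemidef.isHermitian.apply q p
  simp only [mulVec, dotProduct, Fintype.sum_prod_type, normMat, Matrix.of_apply, diagVec,
    mul_ite, mul_zero, Finset.sum_ite_eq, Finset.mem_univ, if_true, powWeight_self hb, h1,
    ← Finset.sum_mul, h2, diagonal_apply, conjTranspose_apply, star_mul', Complex.star_def,
    Complex.conj_ofReal, h3]
  split_ifs with hij
  · subst hij
    rw [powWeight_self ha, ofReal_mul_inv_sqrt (ha _)]
  · simp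

theorem star_diagVec_dotProduct_toCoord (ha : ∀ i, 0 ≤ a i) (k : ℝ) {n : ℕ}
    (X : Matrix (Fin n → A) (Fin n → A) ℂ) :
    (star fun p : Fin n → A × A => ∏ t, diagVec a (p t)) ⬝ᵥ toCoord k a X =
      ∑ i, ((∏ t, a (i t) : ℝ) : ℂ) * X i i := by
  have h1 (i j : Fin n → A) : star (∏ t, diagVec a (i t, j t)) *
      ((∏ t, (√(powWeight k a (i t) (j t)) : ℂ)) * X i j) =
      if i = j then ((∏ t, a (i t) : ℝ) : ℂ) * X i i else 0 := by
    split_ifs with hij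
    · subst hij
      rw [← mul_assoc, star_prod, ← Finset.prod_mul_distrib]
      push_cast
      congr 1
      refine Finset.prod_congr rfl fun t _ => ?_
      rw [powWeight_self ha, diagVec, if_pos rfl, Complex.star_def, Complex.conj_ofReal,
        ← Complex.ofReal_mul, Real.mul_self_sqrt (ha _)]
    · obtain ⟨t, ht⟩ := Function.ne_iff.1 hij
      rw [Finset.prod_eq_zero (Finset.mem_univ t) (by simp [diagVec, ht])]
      simp
  have := sum_arrow_prod fun i j : Fin n → A => star (∏ t, diagVec a (i t, j t)) *
      ((∏ t, (√(powWeight k a (i t) (j t)) : ℂ)) * X i j)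
  simp only [h1, Finset.sum_ite_eq, Finset.mem_univ, if_true] at this
  rw [← this]
  refine Finset.sum_congr rfl fun p _ => ?_
  rw [← h1]
  rfl

/-- In orthonormal coordinates the correlation form of `n` copies is the `n`-th tensor power of that
of one copy. No information is lost in directions of weight zero, as `ρ` vanishes there. -/
theorem DiagMarginals.corr_tensorPower (h : DiagMarginals ρ a b) (ha : ∀ i, 0 ≤ a i)
    (hb : ∀ i, 0 ≤ b i) (k : ℝ) {n : ℕ} (X : Matrix (Fin n → A) (Fin n → A) ℂ)
    (Y : Matrix (Fin n → B) (Fin n → B) ℂ) :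
    corr (tensorPower ρ n) X Y =
      star (toCoord k b Y) ⬝ᵥ (tpow (normMat k a b ρ) n *ᵥ toCoord k a X) := by
  have h1 (p : A × A) (q : B × B) : (√(powWeight k b q.1 q.2) : ℂ) * normMat k a b ρ q p *
      (√(powWeight k a p.1 p.2) : ℂ) = ρ (p.2, q.1) (p.1, q.2) := by
    rw [normMat, Matrix.of_apply]
    by_cases hp : a p.1 = 0 ∨ a p.2 = 0
    · simp [h.apply_eq_zero_left hp]
    by_cases hq : b q.1 = 0 ∨ b q.2 = 0
    · simp [h.apply_eq_zero_right hq]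
    have hp' : ((√(powWeight k a p.1 p.2) : ℝ) : ℂ) ≠ 0 := by
      exact_mod_cast (Real.sqrt_pos.2 (powWeight_pos ha k hp)).ne'
    have hq' : ((√(powWeight k b q.1 q.2) : ℝ) : ℂ) ≠ 0 := by
      exact_mod_cast (Real.sqrt_pos.2 (powWeight_pos hb k hq)).ne'
    push_cast
    field_simp
  rw [corr_eq_sum]
  have h2 := sum_arrow_prod (M := ℂ) fun i j : Fin n → A => ∑ k, ∑ l, X i j * star (Y k l) *
    tensorPower ρ n (j, k) (i, l)
  rw [← h2]
  simp only [dotProduct, mulVec, Finset.mul_sum]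
  refine Eq.trans ?_ Finset.sum_comm
  refine Finset.sum_congr rfl fun p _ => ?_
  rw [← sum_arrow_prod (M := ℂ) fun k l : Fin n → B => X (fun t => (p t).1) (fun t => (p t).2) *
    star (Y k l) * tensorPower ρ n (fun t => (p t).2, k) (fun t => (p t).1, l)]
  refine Finset.sum_congr rfl fun q _ => ?_
  simp only [tensorPower, tpow, toCoord, Matrix.of_apply, Pi.star_apply, star_mul', star_prod,
    Complex.star_def, Complex.conj_ofReal]
  have h3 : ∏ t, ((√(powWeight k b (q t).1 (q t).2) : ℂ) * normMat k a b ρ (q t) (p t) *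
      (√(powWeight k a (p t).1 (p t).2) : ℂ)) = ∏ t, ρ ((p t).2, (q t).1) ((p t).1, (q t).2) :=
    Finset.prod_congr rfl fun t _ => h1 (p t) (q t)
  rw [← h3, Finset.prod_mul_distrib, Finset.prod_mul_distrib]
  ring

/-- A bound by `s ≤ 1` on the correlations of mean-zero operators on one copy holds on any number
of copies. -/
theorem DiagMarginals.norm_corr_tensorPower_le (h : DiagMarginals ρ a b) (ha : ∀ i, 0 ≤ a i)
    (hb : ∀ i, 0 ≤ b i) (ha1 : ∑ i, a i = 1) {k s : ℝ} (hs0 : 0 ≤ s) (hs1 : s ≤ 1)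
    (hs : ∀ X Y, ∑ i, (a i : ℂ) * X i i = 0 → ∑ i, (b i : ℂ) * Y i i = 0 →
      ‖corr ρ X Y‖ ≤ s * √(wsq (powWeight k a) X * wsq (powWeight k b) Y))
    {n : ℕ} (X : Matrix (Fin n → A) (Fin n → A) ℂ) (Y : Matrix (Fin n → B) (Fin n → B) ℂ)
    (hX : ∑ i, ((∏ t, a (i t) : ℝ) : ℂ) * X i i = 0) :
    ‖corr (tensorPower ρ n) X Y‖ ≤ s * √(wsq (powWeight k fun i : Fin n → A => ∏ t, a (i t)) X *
      wsq (powWeight k fun i : Fin n → B => ∏ t, b (i t)) Y) := by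
  have hu := star_diagVec_dotProduct_self ha ha1
  have hgap := posSemidef_gap_of_bound hu (h.normMat_mulVec_diagVec ha hb k)
    (h.conjTranspose_normMat_mulVec_diagVec ha hb k) (s := s) fun y x hy hx => by
      rw [star_dotProduct_normMat_mulVec]
      refine (hs _ _ (by rw [sum_mul_ofCoord ha, hx]) (by rw [sum_mul_ofCoord hb, hy])).trans ?_
      rw [mul_comm (∑ i, ‖y i‖ ^ 2)]
      gcongr
      · exact wsq_nonneg (powWeight_nonneg hb k) _
      · exact wsq_ofCoord_le ha k x
      · exact wsq_ofCoord_le hb k y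
  rw [h.corr_tensorPower ha hb k, ← sum_norm_toCoord_sq ha, ← sum_norm_toCoord_sq hb,
    mul_comm (∑ p, ‖toCoord k a X p‖ ^ 2)]
  exact norm_dotProduct_tpow_le hu hs0 hs1 hgap n _ _
    (by rw [star_diagVec_dotProduct_toCoord ha, hX])

end

/-! ### Effects with asymptotically perfect correlation -/

/-- The effects `E_n`, `F_n` of two local yes-no measurements on `n` copies of `ρ` both have
probability tending to `p ∈ (0,1)`, and so has their joint occurrence. -/
def HasCorrelatedEffects {A B : Type*} [Fintype A] [DecidableEq A] [Fintype B] [DecidableEq B]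
    (ρ : Matrix (A × B) (A × B) ℂ) : Prop :=
  ∃ (p : ℝ) (E : ∀ n : ℕ, Matrix (Fin n → A) (Fin n → A) ℂ)
    (F : ∀ n : ℕ, Matrix (Fin n → B) (Fin n → B) ℂ), 0 < p ∧ p < 1 ∧
    (∀ n, (E n).PosSemidef ∧ (1 - E n).PosSemidef) ∧
    (∀ n, (F n).PosSemidef ∧ (1 - F n).PosSemidef) ∧
    Tendsto (fun n => corr (tensorPower ρ n) (E n) (F n)) atTop (𝓝 p) ∧
    Tendsto (fun n => corr (tensorPower ρ n) (E n) 1) atTop (𝓝 p) ∧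
    Tendsto (fun n => corr (tensorPower ρ n) 1 (F n)) atTop (𝓝 p)

section Variance
variable {A : Type*} [Fintype A]

/-- By the inequality of the weighted means, `a_i^k a_j^(1-k) ≤ k a_i + (1-k) a_j`, and both linear
weights give `Tr[X² σ]` when `X` is Hermitian. -/
theorem wsq_powWeight_le_of_isHermitian {a : A → ℝ} (ha : ∀ i, 0 ≤ a i) {k : ℝ} (hk0 : 0 ≤ k)
    (hk1 : k ≤ 1) {X : Matrix A A ℂ} (hX : X.IsHermitian) :
    wsq (powWeight k a) X ≤ wsq (fun _ j => a j) X := by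
  have h1 : wsq (powWeight k a) X ≤
      k * wsq (fun i _ => a i) X + (1 - k) * wsq (fun _ j => a j) X := by
    simp only [wsq, Finset.mul_sum, ← Finset.sum_add_distrib]
    refine Finset.sum_le_sum fun i _ => Finset.sum_le_sum fun j _ => ?_
    have := Real.geom_mean_le_arith_mean2_weighted hk0 (sub_nonneg.2 hk1) (ha i) (ha j)
      (by ring)
    have := mul_le_mul_of_nonneg_left this (sq_nonneg ‖X i j‖)
    rw [powWeight]
    linarith
  have h2 : wsq (fun i _ => a i) X = wsq (fun _ j => a j) X := by
    rw [← wsq_conjTranspose, hX.eq]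
  rw [h2] at h1
  linarith

theorem sum_prod_eq_one {a : A → ℝ} (ha1 : ∑ i, a i = 1) (n : ℕ) :
    ∑ i : Fin n → A, ∏ t, a (i t) = 1 := by
  have := Finset.prod_univ_sum (fun _ : Fin n => (Finset.univ : Finset A)) fun _ => a
  rw [Fintype.piFinset_univ] at this
  rw [← this]
  simp [ha1]

theorem sum_ofReal_mul_eq_re {a : A → ℝ} {X : Matrix A A ℂ} (hX : X.IsHermitian) :
    ∑ i, (a i : ℂ) * X i i = ((∑ i, (a i : ℂ) * X i i).re : ℝ) := by
  refine (Complex.conj_eq_iff_re.1 ?_).symm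
  rw [map_sum]
  refine Finset.sum_congr rfl fun i _ => ?_
  rw [map_mul, Complex.conj_ofReal]
  congr 1
  exact hX.apply i i

variable [DecidableEq A]

/-- An effect `E` of probability `e` satisfies `Tr[(E - e)² σ] ≤ e - e²`, because `E² ≤ E`. -/
theorem wsq_effect_le {a : A → ℝ} (ha : ∀ i, 0 ≤ a i) (ha1 : ∑ i, a i = 1) {k : ℝ}
    (hk0 : 0 ≤ k) (hk1 : k ≤ 1) {E : Matrix A A ℂ} (hE : E.PosSemidef)
    (hE1 : (1 - E).PosSemidef) {e : ℝ} (he : ∑ i, (a i : ℂ) * E i i = e) :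
    wsq (powWeight k a) (E - (e : ℂ) • 1) ≤ e - e ^ 2 := by
  have hX : (E - (e : ℂ) • 1).IsHermitian := by
    refine hE.isHermitian.sub ?_
    simp [IsHermitian, conjTranspose_smul]
  refine (wsq_powWeight_le_of_isHermitian ha hk0 hk1 hX).trans ?_
  have hpos : (E - E * E).PosSemidef := by
    -- `E - E² = E (1 - E) E + (1 - E) E (1 - E)`
    have h1 := (hE1.mul_mul_conjTranspose_same E).add (hE.mul_mul_conjTranspose_same (1 - E))
    rw [hE.isHermitian.eq, hE1.isHermitian.eq] at h1
    convert h1 using 1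
    noncomm_ring
  have hd (i : A) : 0 ≤ a i * ((E i i).re - ((E * E) i i).re) := by
    refine mul_nonneg (ha i) ?_
    have := (Complex.le_def.1 (hpos.diag_nonneg (i := i))).1
    simpa using this
  have hsum := Finset.sum_nonneg fun i (_ : i ∈ Finset.univ) => hd i
  have he' : ∑ i, a i * (E i i).re = e := by
    have := congrArg Complex.re he
    simpa [Complex.re_sum] using this
  rw [← trace_conjTranspose_mul_self_mul_diagonal, hX.eq]
  have hsq : (E - (e : ℂ) • 1) * (E - (e : ℂ) • 1) =
      E * E - ((2 * e : ℝ) : ℂ) • E + ((e ^ 2 : ℝ) : ℂ) • 1 := by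
    rw [Matrix.mul_sub, Matrix.sub_mul, Matrix.sub_mul, Matrix.smul_mul, Matrix.smul_mul,
      Matrix.one_mul, Matrix.mul_smul, Matrix.mul_one, Matrix.mul_smul, Matrix.mul_one, smul_smul]
    push_cast
    rw [two_mul, add_smul, sq]
    abel
  rw [hsq]
  simp only [Matrix.trace, Matrix.diag_apply, Matrix.mul_diagonal]
  simp only [Matrix.add_apply, Matrix.sub_apply, Matrix.smul_apply, Matrix.one_apply_eq,
    smul_eq_mul, mul_one, Complex.re_sum, Complex.re_mul_ofReal, Complex.add_re, Complex.sub_re,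
    Complex.re_ofReal_mul, Complex.ofReal_re]
  have e1 : ∑ i, (((E * E) i i).re - 2 * e * (E i i).re + e ^ 2) * a i =
      ∑ i, (-(a i * ((E i i).re - ((E * E) i i).re)) + a i * (E i i).re
        - 2 * e * (a i * (E i i).re) + e ^ 2 * a i) :=
    Finset.sum_congr rfl fun i _ => by ring
  rw [e1, Finset.sum_add_distrib, Finset.sum_sub_distrib, Finset.sum_add_distrib,
    Finset.sum_neg_distrib, ← Finset.mul_sum, ← Finset.mul_sum, he', ha1]
  linarith

end Variance

section
variable {A B : Type*} [Fintype A] [Fintype B]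

theorem corr_sub_left (ρ : Matrix (A × B) (A × B) ℂ) (X X' : Matrix A A ℂ) (Y : Matrix B B ℂ) :
    corr ρ (X - X') Y = corr ρ X Y - corr ρ X' Y := by
  simp only [corr_eq_sum, ← Finset.sum_sub_distrib, Matrix.sub_apply, sub_mul]

theorem corr_sub_right (ρ : Matrix (A × B) (A × B) ℂ) (X : Matrix A A ℂ) (Y Y' : Matrix B B ℂ) :
    corr ρ X (Y - Y') = corr ρ X Y - corr ρ X Y' := by
  simp only [corr_eq_sum, ← Finset.sum_sub_distrib, Matrix.sub_apply, star_sub, mul_sub, sub_mul]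

theorem corr_smul_left (ρ : Matrix (A × B) (A × B) ℂ) (c : ℂ) (X : Matrix A A ℂ)
    (Y : Matrix B B ℂ) : corr ρ (c • X) Y = c * corr ρ X Y := by
  simp only [corr_eq_sum, Finset.mul_sum, Matrix.smul_apply, smul_eq_mul, mul_assoc]

theorem corr_smul_right (ρ : Matrix (A × B) (A × B) ℂ) (c : ℂ) (X : Matrix A A ℂ)
    (Y : Matrix B B ℂ) : corr ρ X (c • Y) = star c * corr ρ X Y := by
  simp only [corr_eq_sum, Finset.mul_sum, Matrix.smul_apply, smul_eq_mul, star_mul']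
  refine Finset.sum_congr rfl fun i _ => Finset.sum_congr rfl fun j _ =>
    Finset.sum_congr rfl fun k _ => Finset.sum_congr rfl fun l _ => by ring

theorem margA_tensorPower {A B : Type*} [Fintype B] (ρ : Matrix (A × B) (A × B) ℂ) (n : ℕ) :
    margA (tensorPower ρ n) = tpow (margA ρ) n := by
  ext i j
  simp only [margA, tensorPower, tpow, Matrix.of_apply]
  rw [Finset.prod_univ_sum, Fintype.piFinset_univ]

theorem margB_tensorPower {A B : Type*} [Fintype A] (ρ : Matrix (A × B) (A × B) ℂ) (n : ℕ) :
    margB (tensorPower ρ n) = tpow (margB ρ) n := by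
  ext i j
  simp only [margB, tensorPower, tpow, Matrix.of_apply]
  rw [Finset.prod_univ_sum, Fintype.piFinset_univ]

theorem tpow_diagonal {A : Type*} [DecidableEq A] (d : A → ℂ) (n : ℕ) :
    tpow (Matrix.diagonal d) n = Matrix.diagonal fun i => ∏ t, d (i t) := by
  ext i j
  simp [tpow, Matrix.diagonal_apply, Finset.prod_ite_zero, funext_iff]

theorem corr_one_right [DecidableEq B] (ρ : Matrix (A × B) (A × B) ℂ) (X : Matrix A A ℂ) :
    corr ρ X 1 = (X * margA ρ).trace := by
  rw [corr, conjTranspose_one, trace_kronecker_one_mul]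

theorem corr_one_left [DecidableEq A] (ρ : Matrix (A × B) (A × B) ℂ) (Y : Matrix B B ℂ) :
    corr ρ 1 Y = (Yᴴ * margB ρ).trace := by
  rw [corr, trace_one_kronecker_mul]

variable [DecidableEq A] [DecidableEq B] {ρ : Matrix (A × B) (A × B) ℂ} {a : A → ℝ} {b : B → ℝ}

theorem DiagMarginals.corr_tensorPower_one_right (h : DiagMarginals ρ a b) {n : ℕ}
    (X : Matrix (Fin n → A) (Fin n → A) ℂ) :
    corr (tensorPower ρ n) X 1 = ∑ i, ((∏ t, a (i t) : ℝ) : ℂ) * X i i := by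
  rw [corr_one_right, margA_tensorPower, h.margA_eq, tpow_diagonal, Matrix.trace]
  simp [Matrix.mul_diagonal, mul_comm]

theorem DiagMarginals.corr_tensorPower_one_left (h : DiagMarginals ρ a b) {n : ℕ}
    {Y : Matrix (Fin n → B) (Fin n → B) ℂ} (hY : Y.IsHermitian) :
    corr (tensorPower ρ n) 1 Y = ∑ i, ((∏ t, b (i t) : ℝ) : ℂ) * Y i i := by
  rw [corr_one_left, margB_tensorPower, h.margB_eq, tpow_diagonal, Matrix.trace, hY.eq]
  simp [Matrix.mul_diagonal, mul_comm]

/-- A correlation bound by `s` on one copy bounds the covariance of effects on `n` copies by `s`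
times their standard deviations; perfectly correlated effects in the limit force `1 ≤ s`. -/
theorem DiagMarginals.one_le_of_hasCorrelatedEffects (h : DiagMarginals ρ a b)
    (ha : ∀ i, 0 ≤ a i) (hb : ∀ i, 0 ≤ b i) (ha1 : ∑ i, a i = 1) (hb1 : ∑ i, b i = 1)
    {k s : ℝ} (hk0 : 0 ≤ k) (hk1 : k ≤ 1) (hs0 : 0 ≤ s) (hs1 : s ≤ 1)
    (hs : ∀ X Y, ∑ i, (a i : ℂ) * X i i = 0 → ∑ i, (b i : ℂ) * Y i i = 0 →
      ‖corr ρ X Y‖ ≤ s * √(wsq (powWeight k a) X * wsq (powWeight k b) Y))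
    (hρ : HasCorrelatedEffects ρ) : 1 ≤ s := by
  obtain ⟨p, E, F, hp0, hp1, hE, hF, hEF, hE1, hF1⟩ := hρ
  have key (n : ℕ) : ‖corr (tensorPower ρ n) (E n) (F n) -
      corr (tensorPower ρ n) (E n) 1 * corr (tensorPower ρ n) 1 (F n)‖ ≤
      s * √(((corr (tensorPower ρ n) (E n) 1).re - (corr (tensorPower ρ n) (E n) 1).re ^ 2) *
        ((corr (tensorPower ρ n) 1 (F n)).re - (corr (tensorPower ρ n) 1 (F n)).re ^ 2)) := by
    have han (i : Fin n → A) : 0 ≤ ∏ t, a (i t) := Finset.prod_nonneg fun t _ => ha _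
    have hbn (i : Fin n → B) : 0 ≤ ∏ t, b (i t) := Finset.prod_nonneg fun t _ => hb _
    have hEe := sum_ofReal_mul_eq_re (a := fun i : Fin n → A => ∏ t, a (i t))
      (hE n).1.isHermitian
    have hFe := sum_ofReal_mul_eq_re (a := fun i : Fin n → B => ∏ t, b (i t))
      (hF n).1.isHermitian
    have h11 : corr (tensorPower ρ n) 1 1 = 1 := by
      rw [h.corr_tensorPower_one_right]
      simp only [Matrix.one_apply_eq, mul_one]
      rw [← Complex.ofReal_sum, sum_prod_eq_one ha1, Complex.ofReal_one]
    rw [← h.corr_tensorPower_one_right] at hEe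
    rw [← h.corr_tensorPower_one_left (hF n).1.isHermitian] at hFe
    set e := (corr (tensorPower ρ n) (E n) 1).re
    set f := (corr (tensorPower ρ n) 1 (F n)).re
    have hmean : ∑ i, ((∏ t, a (i t) : ℝ) : ℂ) * (E n - (e : ℂ) • 1) i i = 0 := by
      rw [← h.corr_tensorPower_one_right, corr_sub_left, corr_smul_left, h11, hEe, mul_one,
        sub_self]
    have := h.norm_corr_tensorPower_le ha hb ha1 hs0 hs1 hs (E n - (e : ℂ) • 1)
      (F n - (f : ℂ) • 1) hmean
    have hcov : corr (tensorPower ρ n) (E n - (e : ℂ) • 1) (F n - (f : ℂ) • 1) =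
        corr (tensorPower ρ n) (E n) (F n) -
        corr (tensorPower ρ n) (E n) 1 * corr (tensorPower ρ n) 1 (F n) := by
      simp only [corr_sub_left, corr_sub_right, corr_smul_left, corr_smul_right, h11, hEe, hFe,
        Complex.star_def, Complex.conj_ofReal]
      ring
    rw [hcov] at this
    refine this.trans ?_
    have hwE := wsq_effect_le han (sum_prod_eq_one ha1 n) hk0 hk1 (hE n).1 (hE n).2 (e := e)
      (by rw [← h.corr_tensorPower_one_right, hEe])
    have hwF := wsq_effect_le hbn (sum_prod_eq_one hb1 n) hk0 hk1 (hF n).1 (hF n).2 (e := f)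
      (by rw [← h.corr_tensorPower_one_left (hF n).1.isHermitian, hFe])
    gcongr
    · exact wsq_nonneg (powWeight_nonneg hbn k) _
    · exact (wsq_nonneg (powWeight_nonneg han k) _).trans hwE
  have hre {u : ℕ → ℂ} (hu : Tendsto u atTop (𝓝 (p : ℂ))) :
      Tendsto (fun n => (u n).re) atTop (𝓝 p) := by
    have := (Complex.continuous_re.tendsto _).comp hu
    rwa [Complex.ofReal_re] at this
  have hlim := le_of_tendsto_of_tendsto' (hEF.sub (hE1.mul hF1)).norm
    (((((hre hE1).sub ((hre hE1).pow 2)).mul ((hre hF1).sub ((hre hF1).pow 2))).sqrt).const_mul s)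
    key
  have hpp : 0 < p - p ^ 2 := by nlinarith
  rw [Real.sqrt_mul_self hpp.le, ← Complex.ofReal_mul, ← Complex.ofReal_sub, Complex.norm_real,
    ← sq, Real.norm_of_nonneg hpp.le] at hlim
  nlinarith

end

/-! ### Effects from channels -/

/-- The effect of the outcome `x` when the output of the map `E` is measured in the standard basis:
the matrix `T` with `(E X)_xx = Tr[T X]`. -/
def outcomeEffect {A C : Type*} [DecidableEq A] (E : Matrix A A ℂ →ₗ[ℂ] Matrix C C ℂ) (x : C) :
    Matrix A A ℂ :=
  Matrix.of fun j i => E (Matrix.single i j 1) x x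

section
variable {A B C D : Type*} [Fintype A] [DecidableEq A] [Fintype B] [DecidableEq B]

/-- The outcome effects of a channel are positive: their transposes are principal submatrices of
its Choi matrix. -/
theorem IsChannel.posSemidef_outcomeEffect [Fintype C] {E : Matrix A A ℂ →ₗ[ℂ] Matrix C C ℂ}
    (hE : IsChannel E) (x : C) : (outcomeEffect E x).PosSemidef := by
  let e : Fin (Fintype.card A) ≃ A := (Fintype.equivFin A).symm
  -- `Ω` is the unnormalized maximally entangled vector.
  let Ω : Fin (Fintype.card A) × A → ℂ := fun p => if e p.1 = p.2 then 1 else 0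
  have h := (hE.completelyPositive _ _ (posSemidef_vecMulVec_self_star Ω)).submatrix
    fun i : A => (e.symm i, x)
  refine (iff_of_eq (congrArg Matrix.PosSemidef ?_)).2 h.transpose
  ext j i
  simp only [outcomeEffect, mapTensor, Matrix.of_apply, Matrix.transpose_apply,
    Matrix.submatrix_apply, Matrix.sum_apply, Matrix.smul_apply, kroneckerMap_apply,
    LinearMap.id_apply, vecMulVec_apply, smul_eq_mul, Pi.star_apply, Ω]
  rw [Finset.sum_eq_single (e.symm i) _ (by simp), Finset.sum_eq_single (e.symm j) _ (by simp),
    Finset.sum_eq_single i _ (by simp), Finset.sum_eq_single j _ (by simp)]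
  · simp
  · intro b _ hb
    simp [hb.symm]
  · intro b _ hb
    simp [hb.symm]
  · intro b _ hb
    simp [hb]
  · intro b _ hb
    simp [hb]

theorem IsChannel.sum_outcomeEffect [Fintype C] {E : Matrix A A ℂ →ₗ[ℂ] Matrix C C ℂ}
    (hE : IsChannel E) : ∑ x, outcomeEffect E x = 1 := by
  ext j i
  have := hE.tracePreserving (Matrix.single i j 1)
  simp only [Matrix.sum_apply, outcomeEffect, Matrix.of_apply]
  refine this.trans ?_
  by_cases h : j = i
  · subst h
    simp
  · rw [Matrix.trace_single_eq_of_ne _ _ _ (Ne.symm h), Matrix.one_apply_ne h]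

theorem mapTensor_apply_self [Fintype D] {E : Matrix A A ℂ →ₗ[ℂ] Matrix C C ℂ}
    {F : Matrix B B ℂ →ₗ[ℂ] Matrix D D ℂ} (hF : IsChannel F) (M : Matrix (A × B) (A × B) ℂ)
    (x : C) (y : D) :
    mapTensor E F M (x, y) (x, y) = corr M (outcomeEffect E x) (outcomeEffect F y) := by
  have hS (k l : B) : star (outcomeEffect F y k l) = F (Matrix.single k l 1) y y :=
    (hF.posSemidef_outcomeEffect y).isHermitian.apply l k
  rw [corr_eq_sum, mapTensor]
  simp only [Matrix.sum_apply, Matrix.smul_apply, kroneckerMap_apply, smul_eq_mul, hS]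
  rw [Finset.sum_comm]
  refine Finset.sum_congr rfl fun j _ => Finset.sum_congr rfl fun i _ =>
    Finset.sum_congr rfl fun k _ => Finset.sum_congr rfl fun l _ => ?_
  simp only [outcomeEffect, Matrix.of_apply]
  ring

theorem norm_apply_le_traceNorm (M : Matrix A A ℂ) (i j : A) : ‖M i j‖ ≤ traceNorm M := by
  have hM := posSemidef_conjTranspose_mul_self M
  have h1 : ‖M i j‖ ^ 2 ≤ ((Mᴴ * M).trace).re := by
    simp only [Matrix.trace, Matrix.diag_apply, Matrix.mul_apply, conjTranspose_apply,
      Complex.star_def, Complex.conj_mul', ← Complex.ofReal_pow, ← Complex.ofReal_sum,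
      Complex.ofReal_re]
    exact (Finset.single_le_sum (f := fun i => ‖M i j‖ ^ 2) (fun _ _ => sq_nonneg _)
      (Finset.mem_univ i)).trans (Finset.single_le_sum (f := fun j => ∑ i, ‖M i j‖ ^ 2)
      (fun _ _ => Finset.sum_nonneg fun _ _ => sq_nonneg _) (Finset.mem_univ j))
  have h2 : ((Mᴴ * M).trace).re =
      ∑ i, √((Matrix.isHermitian_conjTranspose_mul_self M).eigenvalues i) ^ 2 := by
    rw [(Matrix.isHermitian_conjTranspose_mul_self M).trace_eq_sum_eigenvalues, Complex.re_sum]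
    exact Finset.sum_congr rfl fun i _ => (Real.sq_sqrt (hM.eigenvalues_nonneg i)).symm
  refine abs_le_of_sq_le_sq' ?_ (Finset.sum_nonneg fun _ _ => Real.sqrt_nonneg _) |>.2
  rw [h2] at h1
  exact h1.trans (Finset.sum_sq_le_sq_sum_of_nonneg fun _ _ => Real.sqrt_nonneg _)

/-- Measuring the outputs of the channels in the standard basis gives correlated effects. The joint
probabilities are diagonal entries of the output, and the marginal ones are sums of two of them. -/
theorem HasAsymptoticCommonData.hasCorrelatedEffects {ρ : Matrix (A × B) (A × B) ℂ}
    (h : HasAsymptoticCommonData ρ) : HasCorrelatedEffects ρ := by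
  obtain ⟨p, E, F, hp0, hp1, hE, hF, hlim⟩ := h
  have hent (x y : Fin 2) : Tendsto (fun n => corr (tensorPower ρ n) (outcomeEffect (E n) x)
      (outcomeEffect (F n) y)) atTop (𝓝 (corrBit p (x, y) (x, y))) := by
    rw [tendsto_iff_norm_sub_tendsto_zero]
    refine squeeze_zero (fun _ => norm_nonneg _) (fun n => ?_) hlim
    rw [← mapTensor_apply_self (hF n), ← Matrix.sub_apply]
    exact norm_apply_le_traceNorm _ _ _
  have h00 := hent 0 0
  have h01 := hent 0 1
  have h10 := hent 1 0
  have e00 : corrBit p (0, 0) (0, 0) = p := by simp [corrBit]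
  have e01 : corrBit p (0, 1) (0, 1) = 0 := by simp [corrBit]
  have e10 : corrBit p (1, 0) (1, 0) = 0 := by simp [corrBit]
  rw [e00] at h00
  rw [e01] at h01
  rw [e10] at h10
  have hE1 (n : ℕ) : 1 - outcomeEffect (E n) 0 = outcomeEffect (E n) 1 := by
    rw [← (hE n).sum_outcomeEffect, Fin.sum_univ_two, add_sub_cancel_left]
  have hF1 (n : ℕ) : 1 - outcomeEffect (F n) 0 = outcomeEffect (F n) 1 := by
    rw [← (hF n).sum_outcomeEffect, Fin.sum_univ_two, add_sub_cancel_left]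
  refine ⟨p, fun n => outcomeEffect (E n) 0, fun n => outcomeEffect (F n) 0, hp0, hp1,
    fun n => ⟨(hE n).posSemidef_outcomeEffect 0, ?_⟩,
    fun n => ⟨(hF n).posSemidef_outcomeEffect 0, ?_⟩, h00, ?_, ?_⟩
  · rw [hE1]
    exact (hE n).posSemidef_outcomeEffect 1
  · rw [hF1]
    exact (hF n).posSemidef_outcomeEffect 1
  · have := h00.add h01
    simp only [← hF1, corr_sub_right, add_sub_cancel, add_zero] at this
    exact this
  · have := h00.add h10
    simp only [← hE1, corr_sub_left, add_sub_cancel, add_zero] at this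
    exact this

/-! ### Local changes of basis -/

/-- `(U ⊗ V)ᴴ ρ (U ⊗ V)`, the matrix `ρ` in local bases given by the columns of `U` and `V`. -/
def localConj (U : Matrix A A ℂ) (V : Matrix B B ℂ) (ρ : Matrix (A × B) (A × B) ℂ) :
    Matrix (A × B) (A × B) ℂ :=
  (U ⊗ₖ V)ᴴ * ρ * (U ⊗ₖ V)

end

section
variable {A B : Type*} [Fintype A] [Fintype B]

theorem corr_localConj (U : Matrix A A ℂ) (V : Matrix B B ℂ) (ρ : Matrix (A × B) (A × B) ℂ)
    (X : Matrix A A ℂ) (Y : Matrix B B ℂ) :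
    corr (localConj U V ρ) X Y = corr ρ (U * X * Uᴴ) (V * Y * Vᴴ) := by
  rw [corr, corr, localConj, ← Matrix.mul_assoc, Matrix.trace_mul_comm, ← Matrix.mul_assoc,
    ← Matrix.mul_assoc, conjTranspose_mul, conjTranspose_mul, conjTranspose_conjTranspose,
    ← Matrix.mul_assoc, mul_kronecker_mul, mul_kronecker_mul, conjTranspose_kronecker]

theorem tensorPower_localConj (U : Matrix A A ℂ) (V : Matrix B B ℂ)
    (ρ : Matrix (A × B) (A × B) ℂ) (n : ℕ) :
    tensorPower (localConj U V ρ) n = localConj (tpow U n) (tpow V n) (tensorPower ρ n) := by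
  have h (M : Matrix (A × B) (A × B) ℂ) : tensorPower M n = (tpow M n).submatrix
      (Equiv.arrowProdEquivProdArrow (Fin n) (fun _ => A) fun _ => B).symm
      (Equiv.arrowProdEquivProdArrow (Fin n) (fun _ => A) fun _ => B).symm := rfl
  have hk : tpow U n ⊗ₖ tpow V n = tensorPower (U ⊗ₖ V) n := by
    ext x y
    simp [tpow, tensorPower, Finset.prod_mul_distrib]
  rw [localConj, localConj, hk, h, h, h, tpow_mul, tpow_mul, tpow_conjTranspose,
    conjTranspose_submatrix, submatrix_mul_equiv, submatrix_mul_equiv]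

variable [DecidableEq A] [DecidableEq B]

theorem margA_localConj {A B : Type*} [Fintype A] [Fintype B] [DecidableEq B]
    (U : Matrix A A ℂ) {V : Matrix B B ℂ} (hV : V * Vᴴ = 1)
    (ρ : Matrix (A × B) (A × B) ℂ) : margA (localConj U V ρ) = Uᴴ * margA ρ * U := by
  refine Matrix.ext_iff_trace_mul_left.2 fun X => ?_
  rw [← corr_one_right, corr_localConj, Matrix.mul_one, hV, corr_one_right,
    ← Matrix.mul_assoc, Matrix.trace_mul_comm _ U]
  simp only [Matrix.mul_assoc]

theorem margB_localConj {A B : Type*} [Fintype A] [Fintype B] [DecidableEq A]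
    {U : Matrix A A ℂ} (hU : U * Uᴴ = 1) (V : Matrix B B ℂ)
    (ρ : Matrix (A × B) (A × B) ℂ) : margB (localConj U V ρ) = Vᴴ * margB ρ * V := by
  refine Matrix.ext_iff_trace_mul_left.2 fun X => ?_
  have := corr_one_left (localConj U V ρ) Xᴴ
  rw [conjTranspose_conjTranspose] at this
  rw [← this, corr_localConj, Matrix.mul_one, hU, corr_one_left, conjTranspose_mul,
    conjTranspose_mul, conjTranspose_conjTranspose, conjTranspose_conjTranspose,
    ← Matrix.mul_assoc, ← Matrix.mul_assoc, Matrix.trace_mul_comm _ V]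
  simp only [Matrix.mul_assoc]

theorem tpow_mul_conjTranspose_self {W : Matrix A A ℂ} (hW : W * Wᴴ = 1) (n : ℕ) :
    tpow W n * (tpow W n)ᴴ = 1 := by
  rw [← tpow_conjTranspose, ← tpow_mul, hW, tpow_one]

theorem conj_conj_cancel {W : Matrix A A ℂ} (hW : W * Wᴴ = 1) (Z : Matrix A A ℂ) :
    W * (Wᴴ * Z * W) * Wᴴ = Z := by
  rw [← Matrix.mul_assoc, ← Matrix.mul_assoc, hW, Matrix.one_mul, Matrix.mul_assoc, hW,
    Matrix.mul_one]

theorem posSemidef_conj_and_one_sub {W Z : Matrix A A ℂ} (hW : W * Wᴴ = 1)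
    (hZ : Z.PosSemidef ∧ (1 - Z).PosSemidef) :
    (Wᴴ * Z * W).PosSemidef ∧ (1 - Wᴴ * Z * W).PosSemidef := by
  refine ⟨hZ.1.conjTranspose_mul_mul_same W, ?_⟩
  have := hZ.2.conjTranspose_mul_mul_same W
  rwa [Matrix.mul_sub, Matrix.sub_mul, Matrix.mul_one, mul_eq_one_comm.1 hW] at this

theorem HasCorrelatedEffects.localConj {ρ : Matrix (A × B) (A × B) ℂ}
    (h : HasCorrelatedEffects ρ) {U : Matrix A A ℂ} {V : Matrix B B ℂ} (hU : U * Uᴴ = 1)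
    (hV : V * Vᴴ = 1) : HasCorrelatedEffects (localConj U V ρ) := by
  obtain ⟨p, E, F, hp0, hp1, hE, hF, hEF, hE1, hF1⟩ := h
  refine ⟨p, fun n => (tpow U n)ᴴ * E n * tpow U n, fun n => (tpow V n)ᴴ * F n * tpow V n,
    hp0, hp1, fun n => posSemidef_conj_and_one_sub (tpow_mul_conjTranspose_self hU n) (hE n),
    fun n => posSemidef_conj_and_one_sub (tpow_mul_conjTranspose_self hV n) (hF n), ?_, ?_, ?_⟩
  · simpa only [tensorPower_localConj, corr_localConj,
      conj_conj_cancel (tpow_mul_conjTranspose_self hU _),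
      conj_conj_cancel (tpow_mul_conjTranspose_self hV _)] using hEF
  · simpa only [tensorPower_localConj, corr_localConj,
      conj_conj_cancel (tpow_mul_conjTranspose_self hU _),
      Matrix.mul_one, tpow_mul_conjTranspose_self hV _] using hE1
  · simpa only [tensorPower_localConj, corr_localConj,
      conj_conj_cancel (tpow_mul_conjTranspose_self hV _),
      Matrix.mul_one, tpow_mul_conjTranspose_self hU _] using hF1

end

/-! ### The inner products in an eigenbasis -/

theorem perspective_fPow {k x y : ℝ} (hk0 : 0 < k) (hk1 : k < 1) (hx : 0 ≤ x) (hy : 0 ≤ y) :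
    perspective (fPow k) x y = x ^ k * y ^ (1 - k) := by
  have hlim_top : Tendsto (fun t : ℝ => fPow k t / t) atTop (𝓝 0) := by
    refine (tendsto_rpow_neg_atTop (sub_pos.2 hk1)).congr' ?_
    filter_upwards [eventually_gt_atTop 0] with t ht
    rw [fPow, neg_sub, Real.rpow_sub_one ht.ne']
  have hlim_zero : Tendsto (fPow k) (𝓝[>] 0) (𝓝 0) := by
    have := (Real.continuousAt_rpow_const 0 k (Or.inr hk0.le)).tendsto.mono_left
      (nhdsWithin_le_nhds (s := Set.Ioi 0))
    rwa [Real.zero_rpow hk0.ne'] at this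
  rw [perspective]
  split_ifs with h1 h2
  · rw [hlim_top.limUnder_eq, h1, Real.zero_rpow (sub_pos.2 hk1).ne', mul_zero, mul_zero]
  · rw [hlim_zero.limUnder_eq, h2, Real.zero_rpow hk0.ne', mul_zero, zero_mul]
  · rw [fPow, Real.div_rpow hx hy, Real.rpow_sub (hy.lt_of_ne' h1), Real.rpow_one]
    ring

theorem fGM_eq_fPow : fGM = fPow (1 / 2) :=
  funext fun x => Real.sqrt_eq_rpow x

section
variable {A : Type*} [Fintype A] [DecidableEq A]

/-- The unitary matrix whose columns are the eigenvectors of `σ`. -/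
def eigU {σ : Matrix A A ℂ} (hσ : σ.IsHermitian) : Matrix A A ℂ :=
  hσ.eigenvectorUnitary

theorem eigU_mul_conjTranspose {σ : Matrix A A ℂ} (hσ : σ.IsHermitian) :
    eigU hσ * (eigU hσ)ᴴ = 1 :=
  Unitary.coe_mul_star_self hσ.eigenvectorUnitary

theorem conjTranspose_eigU_mul {σ : Matrix A A ℂ} (hσ : σ.IsHermitian) :
    (eigU hσ)ᴴ * eigU hσ = 1 :=
  Unitary.coe_star_mul_self hσ.eigenvectorUnitary

theorem conjTranspose_eigU_mul_mul {σ : Matrix A A ℂ} (hσ : σ.IsHermitian) :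
    (eigU hσ)ᴴ * σ * eigU hσ = Matrix.diagonal fun i => (hσ.eigenvalues i : ℂ) := by
  have := hσ.conjStarAlgAut_star_eigenvectorUnitary
  rwa [Unitary.conjStarAlgAut_star_apply] at this

theorem eigenProj_eq {σ : Matrix A A ℂ} (hσ : σ.IsHermitian) (i : A) :
    eigenProj hσ i = eigU hσ * Matrix.single i i 1 * (eigU hσ)ᴴ := by
  ext x y
  rw [eigenProj, vecMulVec_apply, Matrix.mul_apply, Finset.sum_eq_single i]
  · simp [eigU]
  · intro j _ hj
    simp [hj]
  · simp

/-- The inner product belonging to `f` of operators given in an eigenbasis of `σ`. -/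
theorem innerF_conj (f : ℝ → ℝ) {σ : Matrix A A ℂ} (hσ : σ.IsHermitian) (X Y : Matrix A A ℂ) :
    innerF f hσ (eigU hσ * X * (eigU hσ)ᴴ) (eigU hσ * Y * (eigU hσ)ᴴ) =
      ∑ i, ∑ j, (perspective f (hσ.eigenvalues i) (hσ.eigenvalues j) : ℂ) *
        (star (X i j) * Y i j) := by
  have hU := conjTranspose_eigU_mul hσ
  have hterm (i j : A) : ((eigU hσ * X * (eigU hσ)ᴴ)ᴴ *
      (eigenProj hσ i * (eigU hσ * Y * (eigU hσ)ᴴ) * eigenProj hσ j)).trace =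
      star (X i j) * Y i j := by
    rw [eigenProj_eq, eigenProj_eq]
    generalize eigU hσ = U at *
    have e : (U * X * Uᴴ)ᴴ * (U * Matrix.single i i 1 * Uᴴ * (U * Y * Uᴴ) *
        (U * Matrix.single j j 1 * Uᴴ)) =
        U * (Xᴴ * Matrix.single i i 1 * Y * Matrix.single j j 1) * Uᴴ := by
      have hc (Z : Matrix A A ℂ) : Uᴴ * (U * Z) = Z := by
        rw [← Matrix.mul_assoc, hU, Matrix.one_mul]
      simp only [conjTranspose_mul, conjTranspose_conjTranspose, Matrix.mul_assoc, hc]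
    rw [e, Matrix.trace_mul_comm, ← Matrix.mul_assoc, hU, Matrix.one_mul]
    simp only [Matrix.trace, Matrix.diag_apply]
    rw [Finset.sum_eq_single j]
    · rw [Matrix.mul_single_apply_same, Matrix.mul_apply, Finset.sum_eq_single i]
      · simp
      · intro l _ hl
        simp [Matrix.mul_single_apply_of_ne, hl]
      · simp
    · intro l _ hl
      rw [Matrix.mul_single_apply_of_ne _ _ _ _ _ hl]
    · simp
  simp only [innerF, opJ, Matrix.mul_sum, Matrix.trace_sum, Matrix.mul_smul, Matrix.trace_smul,
    hterm, smul_eq_mul]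

theorem innerF_fPow_self {σ : Matrix A A ℂ} (hσ : σ.IsHermitian) (h0 : ∀ i, 0 ≤ hσ.eigenvalues i)
    {k : ℝ} (hk0 : 0 < k) (hk1 : k < 1) (X : Matrix A A ℂ) :
    innerF (fPow k) hσ (eigU hσ * X * (eigU hσ)ᴴ) (eigU hσ * X * (eigU hσ)ᴴ) =
      (wsq (powWeight k hσ.eigenvalues) X : ℂ) := by
  rw [innerF_conj, wsq]
  push_cast
  refine Finset.sum_congr rfl fun i _ => Finset.sum_congr rfl fun j _ => ?_
  rw [perspective_fPow hk0 hk1 (h0 i) (h0 j), Complex.star_def, Complex.conj_mul', powWeight]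
  push_cast
  ring

theorem innerF_fPow_one {σ : Matrix A A ℂ} (hσ : σ.IsHermitian) (h0 : ∀ i, 0 ≤ hσ.eigenvalues i)
    {k : ℝ} (hk0 : 0 < k) (hk1 : k < 1) (X : Matrix A A ℂ) :
    innerF (fPow k) hσ 1 (eigU hσ * X * (eigU hσ)ᴴ) = ∑ i, (hσ.eigenvalues i : ℂ) * X i i := by
  have h1 : (1 : Matrix A A ℂ) = eigU hσ * 1 * (eigU hσ)ᴴ := by
    rw [Matrix.mul_one, eigU_mul_conjTranspose]
  conv_lhs => rw [h1]
  rw [innerF_conj]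
  refine Finset.sum_congr rfl fun i _ => ?_
  rw [Finset.sum_eq_single i]
  · rw [perspective_fPow hk0 hk1 (h0 i) (h0 i)]
    have := powWeight_self (k := k) h0 i
    rw [powWeight] at this
    rw [this]
    simp
  · intro j _ hj
    simp [Matrix.one_apply_ne hj.symm]
  · simp

theorem exists_eq_conj {σ : Matrix A A ℂ} (hσ : σ.IsHermitian) (X : Matrix A A ℂ) :
    ∃ X', X = eigU hσ * X' * (eigU hσ)ᴴ := by
  refine ⟨(eigU hσ)ᴴ * X * eigU hσ, ?_⟩
  rw [conj_conj_cancel (eigU_mul_conjTranspose hσ)]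

end

/-! ### From normalized to arbitrary operators -/

section
variable {A B : Type*} [Fintype A] [Fintype B]

theorem wsq_smul (w : A → A → ℝ) (c : ℂ) (X : Matrix A A ℂ) :
    wsq w (c • X) = ‖c‖ ^ 2 * wsq w X := by
  simp only [wsq, Finset.mul_sum, Matrix.smul_apply, smul_eq_mul, norm_mul, mul_pow, mul_assoc]

theorem wsq_inv_sqrt_smul {w : A → A → ℝ} {X : Matrix A A ℂ} (hX : 0 < wsq w X) :
    wsq w ((((√(wsq w X))⁻¹ : ℝ) : ℂ) • X) = 1 := by
  rw [wsq_smul, Complex.norm_real, Real.norm_eq_abs, sq_abs, inv_pow, Real.sq_sqrt hX.le,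
    inv_mul_cancel₀ hX.ne']

variable [DecidableEq A] [DecidableEq B] {ρ : Matrix (A × B) (A × B) ℂ} {a : A → ℝ} {b : B → ℝ}

/-- A bound on the correlation of the normalized multiples of `X` and `Y` is a bound in terms of
their norms. Operators of norm zero are uncorrelated with everything. -/
theorem DiagMarginals.norm_corr_le_of_normalized (h : DiagMarginals ρ a b) (ha : ∀ i, 0 ≤ a i)
    (hb : ∀ i, 0 ≤ b i) {k s : ℝ} (hk0 : 0 ≤ k) (hk1 : k ≤ 1) {X : Matrix A A ℂ}
    {Y : Matrix B B ℂ} (H : ∀ c d : ℝ, wsq (powWeight k a) ((c : ℂ) • X) = 1 →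
      wsq (powWeight k b) ((d : ℂ) • Y) = 1 → ‖corr ρ ((c : ℂ) • X) ((d : ℂ) • Y)‖ ≤ s) :
    ‖corr ρ X Y‖ ≤ s * √(wsq (powWeight k a) X * wsq (powWeight k b) Y) := by
  rcases (wsq_nonneg (powWeight_nonneg ha k) X).eq_or_lt with hX | hX
  · have := h.norm_corr_le ha hb hk0 hk1 X Y
    simpa [← hX] using this
  rcases (wsq_nonneg (powWeight_nonneg hb k) Y).eq_or_lt with hY | hY
  · have := h.norm_corr_le ha hb hk0 hk1 X Y
    simpa [← hY] using this
  have hX' := Real.sqrt_pos.2 hX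
  have hY' := Real.sqrt_pos.2 hY
  have := H _ _ (wsq_inv_sqrt_smul hX) (wsq_inv_sqrt_smul hY)
  rw [corr_smul_left, corr_smul_right, Complex.star_def, Complex.conj_ofReal, norm_mul, norm_mul,
    Complex.norm_real, Complex.norm_real, Real.norm_of_nonneg (by positivity),
    Real.norm_of_nonneg (by positivity)] at this
  rw [Real.sqrt_mul hX.le]
  field_simp at this
  linarith

/-- The Hermitian real part of an operator. -/
def hermRe {A : Type*} (X : Matrix A A ℂ) : Matrix A A ℂ :=
  (1 / 2 : ℂ) • (X + Xᴴ)

/-- The Hermitian imaginary part of an operator. -/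
def hermIm {A : Type*} (X : Matrix A A ℂ) : Matrix A A ℂ :=
  (-Complex.I / 2) • (X - Xᴴ)

end

section
variable {A B : Type*}

theorem hermRe_isHermitian (X : Matrix A A ℂ) : (hermRe X).IsHermitian := by
  rw [IsHermitian, hermRe, conjTranspose_smul, conjTranspose_add, conjTranspose_conjTranspose,
    add_comm Xᴴ]
  simp

theorem hermIm_isHermitian (X : Matrix A A ℂ) : (hermIm X).IsHermitian := by
  rw [IsHermitian, hermIm, conjTranspose_smul, conjTranspose_sub, conjTranspose_conjTranspose,
    ← neg_sub X, smul_neg, ← neg_smul]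
  congr 1
  simp
  ring

theorem hermRe_add_smul_hermIm (X : Matrix A A ℂ) : X = hermRe X + Complex.I • hermIm X := by
  rw [hermRe, hermIm, smul_smul, mul_div_assoc', mul_neg, Complex.I_mul_I, neg_neg, ← smul_add]
  ext i j
  simp only [Matrix.smul_apply, Matrix.add_apply, Matrix.sub_apply, smul_eq_mul]
  ring

variable [Fintype A] [Fintype B]

/-- For symmetric weights the adjoint is an isometry, so Hermitian operators have real inner
products and the Hermitian and anti-Hermitian parts of `X` are orthogonal for the real inner
product. -/
theorem wsq_eq_hermRe_add_hermIm {w : A → A → ℝ} (hw : ∀ i j, w i j = w j i)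
    (X : Matrix A A ℂ) : wsq w X = wsq w (hermRe X) + wsq w (hermIm X) := by
  have h1 : wsq w X = (1 / 2) * (wsq w X + wsq w Xᴴ) := by
    rw [wsq_conjTranspose, show (fun i j => w j i) = w from funext₂ fun i j => (hw i j).symm]
    ring
  rw [h1]
  simp only [wsq, ← Finset.sum_add_distrib, Finset.mul_sum]
  refine Finset.sum_congr rfl fun i _ => Finset.sum_congr rfl fun j _ => ?_
  have := parallelogram_law_with_norm ℝ (X i j) (Xᴴ i j)
  simp only [hermRe, hermIm, Matrix.smul_apply, Matrix.add_apply, Matrix.sub_apply, smul_eq_mul,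
    norm_mul, norm_div, norm_neg, Complex.norm_I, norm_one, Complex.norm_ofNat]
  linear_combination (-w i j / 4) * this

theorem sum_mul_hermRe {a : A → ℝ} {X : Matrix A A ℂ} (hX : ∑ i, (a i : ℂ) * X i i = 0) :
    ∑ i, (a i : ℂ) * hermRe X i i = 0 := by
  have h2 := congrArg star hX
  simp only [star_sum, star_mul', Complex.star_def, Complex.conj_ofReal, map_zero] at h2
  have h3 : ∑ i, (a i : ℂ) * hermRe X i i =
      (1 / 2) * (∑ i, (a i : ℂ) * X i i + ∑ i, (a i : ℂ) * (starRingEnd ℂ) (X i i)) := by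
    rw [← Finset.sum_add_distrib, Finset.mul_sum]
    refine Finset.sum_congr rfl fun i _ => ?_
    simp only [hermRe, Matrix.smul_apply, Matrix.add_apply, conjTranspose_apply, smul_eq_mul,
      Complex.star_def]
    ring
  rw [h3, hX, h2]
  simp

theorem sum_mul_hermIm {a : A → ℝ} {X : Matrix A A ℂ} (hX : ∑ i, (a i : ℂ) * X i i = 0) :
    ∑ i, (a i : ℂ) * hermIm X i i = 0 := by
  have h2 := congrArg star hX
  simp only [star_sum, star_mul', Complex.star_def, Complex.conj_ofReal, map_zero] at h2
  have h3 : ∑ i, (a i : ℂ) * hermIm X i i = (-Complex.I / 2) *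
      (∑ i, (a i : ℂ) * X i i - ∑ i, (a i : ℂ) * (starRingEnd ℂ) (X i i)) := by
    rw [← Finset.sum_sub_distrib, Finset.mul_sum]
    refine Finset.sum_congr rfl fun i _ => ?_
    simp only [hermIm, Matrix.smul_apply, Matrix.sub_apply, conjTranspose_apply, smul_eq_mul,
      Complex.star_def]
    ring
  rw [h3, hX, h2]
  simp

theorem corr_add_left (ρ : Matrix (A × B) (A × B) ℂ) (X X' : Matrix A A ℂ) (Y : Matrix B B ℂ) :
    corr ρ (X + X') Y = corr ρ X Y + corr ρ X' Y := by
  simp only [corr_eq_sum, ← Finset.sum_add_distrib, Matrix.add_apply, add_mul]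

theorem corr_add_right (ρ : Matrix (A × B) (A × B) ℂ) (X : Matrix A A ℂ) (Y Y' : Matrix B B ℂ) :
    corr ρ X (Y + Y') = corr ρ X Y + corr ρ X Y' := by
  simp only [corr_eq_sum, ← Finset.sum_add_distrib, Matrix.add_apply, star_add, mul_add, add_mul]

theorem re_corr_eq {ρ : Matrix (A × B) (A × B) ℂ} (hρ : ρ.IsHermitian) (X : Matrix A A ℂ)
    (Y : Matrix B B ℂ) : (corr ρ X Y).re =
      (corr ρ (hermRe X) (hermRe Y)).re + (corr ρ (hermIm X) (hermIm Y)).re := by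
  have him {X : Matrix A A ℂ} {Y : Matrix B B ℂ} (hX : X.IsHermitian) (hY : Y.IsHermitian) :
      (corr ρ X Y).im = 0 := by
    have := corr_conjTranspose hρ X Y
    rw [hX.eq, hY.eq] at this
    exact Complex.conj_eq_iff_im.1 this.symm
  conv_lhs => rw [hermRe_add_smul_hermIm X, hermRe_add_smul_hermIm Y]
  simp only [corr_add_left, corr_add_right, corr_smul_left, corr_smul_right, Complex.star_def,
    Complex.conj_I, Complex.add_re, Complex.add_im, Complex.mul_re, Complex.neg_re,
    Complex.neg_im, Complex.mul_im,
    Complex.I_re, Complex.I_im, him (hermRe_isHermitian _) (hermIm_isHermitian _),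
    him (hermIm_isHermitian _) (hermRe_isHermitian _)]
  ring

/-- For symmetric weights, a correlation bound for mean-zero Hermitian operators holds for all
mean-zero operators: after a phase rotation the correlation is real, and only the correlations of
the real parts and of the imaginary parts contribute to it. -/
theorem norm_corr_le_of_hermitian {ρ : Matrix (A × B) (A × B) ℂ} (hρ : ρ.IsHermitian)
    {a : A → ℝ} {b : B → ℝ} {w : A → A → ℝ} {w' : B → B → ℝ} (hw0 : ∀ i j, 0 ≤ w i j)
    (hw0' : ∀ i j, 0 ≤ w' i j) (hw : ∀ i j, w i j = w j i)
    (hw' : ∀ i j, w' i j = w' j i) {s : ℝ} (hs0 : 0 ≤ s)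
    (hs : ∀ X Y, X.IsHermitian → Y.IsHermitian → ∑ i, (a i : ℂ) * X i i = 0 →
      ∑ i, (b i : ℂ) * Y i i = 0 → ‖corr ρ X Y‖ ≤ s * √(wsq w X * wsq w' Y))
    (X : Matrix A A ℂ) (Y : Matrix B B ℂ) (hX : ∑ i, (a i : ℂ) * X i i = 0)
    (hY : ∑ i, (b i : ℂ) * Y i i = 0) : ‖corr ρ X Y‖ ≤ s * √(wsq w X * wsq w' Y) := by
  obtain ⟨c, hc1, hc⟩ := RCLike.exists_norm_eq_mul_self (corr ρ X Y)
  have hc' : ‖corr ρ X Y‖ = (corr ρ (c • X) Y).re := by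
    rw [corr_smul_left, ← hc]
    rfl
  have hcX : ∑ i, (a i : ℂ) * (c • X) i i = 0 := by
    have : ∑ i, (a i : ℂ) * (c • X) i i = c * ∑ i, (a i : ℂ) * X i i := by
      rw [Finset.mul_sum]
      exact Finset.sum_congr rfl fun i _ => by
        rw [Matrix.smul_apply, smul_eq_mul]
        ring
    rw [this, hX, mul_zero]
  have hcw : wsq w (c • X) = wsq w X := by rw [wsq_smul, hc1, one_pow, one_mul]
  rw [hc', re_corr_eq hρ, ← hcw, wsq_eq_hermRe_add_hermIm hw, wsq_eq_hermRe_add_hermIm hw' Y]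
  have h1 := (Complex.re_le_norm _).trans (hs _ _ (hermRe_isHermitian (c • X))
    (hermRe_isHermitian Y) (sum_mul_hermRe hcX) (sum_mul_hermRe hY))
  have h2 := (Complex.re_le_norm _).trans (hs _ _ (hermIm_isHermitian (c • X))
    (hermIm_isHermitian Y) (sum_mul_hermIm hcX) (sum_mul_hermIm hY))
  refine (add_le_add h1 h2).trans ?_
  rw [← mul_add]
  refine mul_le_mul_of_nonneg_left ?_ hs0
  have p1 := wsq_nonneg hw0 (hermRe (c • X))
  have p2 := wsq_nonneg hw0 (hermIm (c • X))
  have q1 := wsq_nonneg hw0' (hermRe Y)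
  have q2 := wsq_nonneg hw0' (hermIm Y)
  generalize wsq w (hermRe (c • X)) = x1 at *
  generalize wsq w (hermIm (c • X)) = x2 at *
  generalize wsq w' (hermRe Y) = y1 at *
  generalize wsq w' (hermIm Y) = y2 at *
  have := Real.sum_sqrt_mul_sqrt_le (Finset.univ : Finset (Fin 2)) (f := ![x1, x2])
    (g := ![y1, y2]) (fun i => by fin_cases i <;> simpa) (fun i => by fin_cases i <;> simpa)
  simpa [Fin.sum_univ_two, Real.sqrt_mul p1, Real.sqrt_mul p2, Real.sqrt_mul (add_nonneg p1 p2)]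
    using this

end

/-! ### The correlation coefficients of a state with asymptotic common data -/

theorem sum_mul_smul_eq_zero {A : Type*} [Fintype A] {a : A → ℝ} {X : Matrix A A ℂ}
    (hX : ∑ i, (a i : ℂ) * X i i = 0) (c : ℂ) : ∑ i, (a i : ℂ) * (c • X) i i = 0 := by
  simp only [Matrix.smul_apply, smul_eq_mul, mul_left_comm _ c, ← Finset.mul_sum, hX, mul_zero]

theorem isHermitian_conj_real_smul {A : Type*} [Fintype A] {X : Matrix A A ℂ} (hX : X.IsHermitian)
    (c : ℝ) (U : Matrix A A ℂ) : (U * ((c : ℂ) • X) * Uᴴ).IsHermitian := by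
  refine isHermitian_mul_mul_conjTranspose U ?_
  rw [IsHermitian, conjTranspose_smul, hX.eq, Complex.star_def, Complex.conj_ofReal]

theorem powWeight_half_symm {C : Type*} (a : C → ℝ) (i j : C) :
    powWeight (1 / 2) a i j = powWeight (1 / 2) a j i := by
  rw [powWeight, powWeight, mul_comm]
  norm_num

section
variable {A B : Type*} [Fintype A] [DecidableEq A] [Fintype B] [DecidableEq B]
  {ρ : Matrix (A × B) (A × B) ℂ}

/-- The eigenvalues of the first marginal of a state. -/
def eigA (hρ : IsState ρ) : A → ℝ :=
  (margA_isHermitian hρ.posSemidef.isHermitian).eigenvalues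

/-- The eigenvalues of the second marginal of a state. -/
def eigB (hρ : IsState ρ) : B → ℝ :=
  (margB_isHermitian hρ.posSemidef.isHermitian).eigenvalues

/-- Eigenvectors of the first marginal of a state. -/
def eigUA (hρ : IsState ρ) : Matrix A A ℂ :=
  eigU (margA_isHermitian hρ.posSemidef.isHermitian)

/-- Eigenvectors of the second marginal of a state. -/
def eigUB (hρ : IsState ρ) : Matrix B B ℂ :=
  eigU (margB_isHermitian hρ.posSemidef.isHermitian)

/-- A state written in eigenbases of its marginals. -/
def diagonalized (hρ : IsState ρ) : Matrix (A × B) (A × B) ℂ :=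
  localConj (eigUA hρ) (eigUB hρ) ρ

theorem IsState.diagMarginals (hρ : IsState ρ) :
    DiagMarginals (diagonalized hρ) (eigA hρ) (eigB hρ) where
  posSemidef := hρ.posSemidef.conjTranspose_mul_mul_same _
  margA_eq := by
    rw [diagonalized, eigUA, eigUB, margA_localConj _ (eigU_mul_conjTranspose _)]
    exact conjTranspose_eigU_mul_mul _
  margB_eq := by
    rw [diagonalized, eigUA, eigUB, margB_localConj (eigU_mul_conjTranspose _)]
    exact conjTranspose_eigU_mul_mul _

theorem eigA_nonneg (hρ : IsState ρ) (i : A) : 0 ≤ eigA hρ i := by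
  have h : margA (diagonalized hρ) i i = (eigA hρ i : ℂ) := by
    rw [hρ.diagMarginals.margA_eq, Matrix.diagonal_apply_eq]
  have h0 : (0 : ℂ) ≤ margA (diagonalized hρ) i i :=
    Finset.sum_nonneg fun k _ => hρ.diagMarginals.posSemidef.diag_nonneg
  rw [h] at h0
  exact_mod_cast h0

theorem eigB_nonneg (hρ : IsState ρ) (k : B) : 0 ≤ eigB hρ k := by
  have h : margB (diagonalized hρ) k k = (eigB hρ k : ℂ) := by
    rw [hρ.diagMarginals.margB_eq, Matrix.diagonal_apply_eq]
  have h0 : (0 : ℂ) ≤ margB (diagonalized hρ) k k :=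
    Finset.sum_nonneg fun i _ => hρ.diagMarginals.posSemidef.diag_nonneg
  rw [h] at h0
  exact_mod_cast h0

theorem sum_eigA {A B : Type*} [Fintype A] [DecidableEq A] [Fintype B]
    {ρ : Matrix (A × B) (A × B) ℂ} (hρ : IsState ρ) : ∑ i, eigA hρ i = 1 := by
  have h := (margA_isHermitian hρ.posSemidef.isHermitian).trace_eq_sum_eigenvalues
  have h1 : (margA ρ).trace = ρ.trace := by
    simp [Matrix.trace, margA, Fintype.sum_prod_type]
  rw [h1, hρ.trace_eq_one] at h
  refine Complex.ofReal_injective ?_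
  rw [Complex.ofReal_sum]
  exact h.symm

theorem sum_eigB {A B : Type*} [Fintype A] [Fintype B] [DecidableEq B]
    {ρ : Matrix (A × B) (A × B) ℂ} (hρ : IsState ρ) : ∑ i, eigB hρ i = 1 := by
  have h := (margB_isHermitian hρ.posSemidef.isHermitian).trace_eq_sum_eigenvalues
  have h1 : (margB ρ).trace = ρ.trace := by
    simp only [Matrix.trace, Matrix.diag_apply, margB, Matrix.of_apply, Fintype.sum_prod_type]
    exact Finset.sum_comm
  rw [h1, hρ.trace_eq_one] at h
  refine Complex.ofReal_injective ?_
  rw [Complex.ofReal_sum]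
  exact h.symm

/-- Feasibility in eigenbases of the marginals. -/
theorem feasible_conj_iff (hρ : IsState ρ) {k : ℝ} (hk0 : 0 < k) (hk1 : k < 1)
    (X : Matrix A A ℂ) (Y : Matrix B B ℂ) :
    Feasible (fPow k) hρ (eigUA hρ * X * (eigUA hρ)ᴴ) (eigUB hρ * Y * (eigUB hρ)ᴴ) ↔
      ∑ i, (eigA hρ i : ℂ) * X i i = 0 ∧ ∑ i, (eigB hρ i : ℂ) * Y i i = 0 ∧
      wsq (powWeight k (eigA hρ)) X = 1 ∧ wsq (powWeight k (eigB hρ)) Y = 1 := by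
  rw [Feasible, eigUA, eigUB, innerF_fPow_one _ (eigA_nonneg hρ) hk0 hk1,
    innerF_fPow_one _ (eigB_nonneg hρ) hk0 hk1, innerF_fPow_self _ (eigA_nonneg hρ) hk0 hk1,
    innerF_fPow_self _ (eigB_nonneg hρ) hk0 hk1]
  norm_cast

theorem norm_trace_le_one_of_feasible (hρ : IsState ρ) {k : ℝ} (hk0 : 0 < k) (hk1 : k < 1)
    {X : Matrix A A ℂ} {Y : Matrix B B ℂ} (h : Feasible (fPow k) hρ X Y) :
    ‖((X ⊗ₖ Yᴴ) * ρ).trace‖ ≤ 1 := by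
  obtain ⟨X, rfl⟩ := exists_eq_conj (margA_isHermitian hρ.posSemidef.isHermitian) X
  obtain ⟨Y, rfl⟩ := exists_eq_conj (margB_isHermitian hρ.posSemidef.isHermitian) Y
  obtain ⟨-, -, h1, h2⟩ := (feasible_conj_iff hρ hk0 hk1 X Y).1 h
  have := hρ.diagMarginals.norm_corr_le (eigA_nonneg hρ) (eigB_nonneg hρ) hk0.le hk1.le X Y
  rw [h1, h2, mul_one, Real.sqrt_one, diagonalized, corr_localConj] at this
  exact this

/-- If `s < 1` bounded the correlations of mean-zero operators, the state could not have common
data asymptotically. -/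
theorem one_le_of_bound (hρ : IsState ρ) (hacd : HasAsymptoticCommonData ρ) {k s : ℝ}
    (hk0 : 0 < k) (hk1 : k < 1) (hs0 : 0 ≤ s)
    (hs : ∀ X Y, ∑ i, (eigA hρ i : ℂ) * X i i = 0 → ∑ i, (eigB hρ i : ℂ) * Y i i = 0 →
      ‖corr (diagonalized hρ) X Y‖ ≤
        s * √(wsq (powWeight k (eigA hρ)) X * wsq (powWeight k (eigB hρ)) Y)) : 1 ≤ s := by
  by_contra! hlt
  exact hlt.not_ge (hρ.diagMarginals.one_le_of_hasCorrelatedEffects (eigA_nonneg hρ)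
    (eigB_nonneg hρ) (sum_eigA hρ) (sum_eigB hρ) hk0.le hk1.le hs0 hlt.le hs
    (hacd.hasCorrelatedEffects.localConj (eigU_mul_conjTranspose _) (eigU_mul_conjTranspose _)))

/-- The coefficient `s = μ_f^Lin` is at most `1` by interpolation, hence a genuine supremum, and so
bounds the correlations of all mean-zero operators; then `1 ≤ s`. -/
theorem muLin_fPow_eq_one (hρ : IsState ρ) (hacd : HasAsymptoticCommonData ρ) {k : ℝ}
    (hk0 : 0 < k) (hk1 : k < 1) : muLin (fPow k) hρ = 1 := by
  have hub : ∀ r ∈ {r : ℝ | ∃ (X : Matrix A A ℂ) (Y : Matrix B B ℂ),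
      Feasible (fPow k) hρ X Y ∧ r = ‖((X ⊗ₖ Yᴴ) * ρ).trace‖}, r ≤ 1 := by
    rintro r ⟨X, Y, h, rfl⟩
    exact norm_trace_le_one_of_feasible hρ hk0 hk1 h
  refine le_antisymm (Real.sSup_le hub zero_le_one) ?_
  have h0 : 0 ≤ muLin (fPow k) hρ := Real.sSup_nonneg (by
    rintro r ⟨X, Y, -, rfl⟩
    exact norm_nonneg _)
  refine one_le_of_bound hρ hacd hk0 hk1 h0 fun X Y hX hY => ?_
  refine hρ.diagMarginals.norm_corr_le_of_normalized (eigA_nonneg hρ) (eigB_nonneg hρ) hk0.le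
    hk1.le fun c d hc hd => le_csSup ⟨1, hub⟩ ⟨_, _, (feasible_conj_iff hρ hk0 hk1 _ _).2
      ⟨sum_mul_smul_eq_zero hX c, sum_mul_smul_eq_zero hY d, hc, hd⟩, ?_⟩
  rw [diagonalized, corr_localConj]
  rfl

/-- For `k = 1/2` the weights are symmetric, and the supremum over Hermitian operators already
bounds the correlations of all mean-zero operators. -/
theorem mu_fGM_eq_one (hρ : IsState ρ) (hacd : HasAsymptoticCommonData ρ) :
    mu fGM hρ = 1 := by
  have hk0 : (0 : ℝ) < 1 / 2 := by norm_num
  have hk1 : (1 / 2 : ℝ) < 1 := by norm_num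
  rw [fGM_eq_fPow]
  have hub : ∀ r ∈ {r : ℝ | ∃ (X : Matrix A A ℂ) (Y : Matrix B B ℂ), X.IsHermitian ∧
      Y.IsHermitian ∧ Feasible (fPow (1 / 2)) hρ X Y ∧ r = ‖((X ⊗ₖ Yᴴ) * ρ).trace‖}, r ≤ 1 := by
    rintro r ⟨X, Y, -, -, h, rfl⟩
    exact norm_trace_le_one_of_feasible hρ hk0 hk1 h
  refine le_antisymm (Real.sSup_le hub zero_le_one) ?_
  have h0 : 0 ≤ mu (fPow (1 / 2)) hρ := Real.sSup_nonneg (by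
    rintro r ⟨X, Y, -, -, -, rfl⟩
    exact norm_nonneg _)
  refine one_le_of_bound hρ hacd hk0 hk1 h0 ?_
  refine norm_corr_le_of_hermitian hρ.diagMarginals.posSemidef.isHermitian
    (powWeight_nonneg (eigA_nonneg hρ) _) (powWeight_nonneg (eigB_nonneg hρ) _)
    (powWeight_half_symm _) (powWeight_half_symm _) h0 fun X Y hXh hYh hX hY => ?_
  refine hρ.diagMarginals.norm_corr_le_of_normalized (eigA_nonneg hρ) (eigB_nonneg hρ) hk0.le
    hk1.le fun c d hc hd => le_csSup ⟨1, hub⟩ ⟨_, _, isHermitian_conj_real_smul hXh c _,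
      isHermitian_conj_real_smul hYh d _, (feasible_conj_iff hρ hk0 hk1 _ _).2
      ⟨sum_mul_smul_eq_zero hX c, sum_mul_smul_eq_zero hY d, hc, hd⟩, ?_⟩
  rw [diagonalized, corr_localConj]
  rfl

end

end QMaxCorr

end

theorem mainTheorem8 {A B : Type*} [Fintype A] [DecidableEq A] [Fintype B] [DecidableEq B]
    (ρ : Matrix (A × B) (A × B) ℂ) (hρ : QMaxCorr.IsState ρ)
    (hacd : QMaxCorr.HasAsymptoticCommonData ρ) :
    (∀ k ∈ Set.Ioo (0 : ℝ) (1 / 2) ∪ Set.Ioo (1 / 2 : ℝ) 1,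
      QMaxCorr.muLin (QMaxCorr.fPow k) hρ = 1) ∧
    QMaxCorr.mu QMaxCorr.fGM hρ = 1 := by
  refine ⟨fun k hk => ?_, QMaxCorr.mu_fGM_eq_one hρ hacd⟩
  rcases hk with ⟨h0, h1⟩ | ⟨h0, h1⟩
  · exact QMaxCorr.muLin_fPow_eq_one hρ hacd h0 (by linarith)
  · exact QMaxCorr.muLin_fPow_eq_one hρ hacd (by linarith) h1
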